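/- Let $F$ be a number field with ring of integers $\mathcal{O}_F$, let $D$ be a skew field with centre $F$ that is finite-dimensional over $F$, and let $\Delta \subseteq D$ be a maximal $\mathcal{O}_F$-order. Let $\mathfrak{g}$ be a non-zero ideal of $\mathcal{O}_F$, put $\overline{\Delta} := \Delta/\mathfrak{g}\Delta$, let $k \geq 2$ be an integer, and let $\pi : GL_k(\Delta) \to GL_k(\overline{\Delta})$ be the natural projection. For a ring $R$ let $E_m(R) \leq GL_m(R)$ be the subgroup generated by the elementary matrices $E_{ij}(x)$ ($i \neq j$, $x \in R$), let $GL(R) = \varinjlim_m GL_m(R)$ and $E(R) = \varinjlim_m E_m(R)$ be the direct limits along the inclusions $A \mapsto \mathrm{diag}(A,1)$, and let $K_1(R) = GL(R)/E(R)$; regard $GL_2(R)$ as a subgroup of $GL_k(R)$ via these inclusions. Let $U' \subseteq GL_2(\Delta)$ be a set of representatives of the natural map $GL_2(\Delta) \to K_1(\Delta)$, in the sense that the image of $U'$ in $K_1(\Delta)$ generates the image of $GL_2(\Delta)$ (for instance, $U'$ contains one element of each non-empty fibre of this map). Then the group $\pi(GL_k(\Delta))$ is generated by $E_k(\overline{\Delta})$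 and $\pi(U')$. -/

import Mathlib

open scoped NumberField

/-! ### General linear groups over a (not necessarily commutative) ring -/

section LinearGroups

variable {R : Type*} [Ring R]

/-- The homomorphism `GL_m(R) → GL_m(S)` that applies a ring homomorphism `R → S` to each entry. -/
def glMap {S : Type*} [Ring S] (m : ℕ) (f : R →+* S) : GL (Fin m) R →* GL (Fin m) S :=
  Units.map (f.mapMatrix : Matrix (Fin m) (Fin m) R →+* Matrix (Fin m) (Fin m) S).toMonoidHom

/-- The block diagonal matrix `diag(A, 1)` of size `n` (for `A` of size `m ≤ n`). -/
def padMatrix {m : ℕ} (n : ℕ) (A : Matrix (Fin m) (Fin m) R) : Matrix (Fin n) (Fin n) R :=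
  Matrix.of fun i j =>
    if h : (i : ℕ) < m ∧ (j : ℕ) < m then A ⟨i, h.1⟩ ⟨j, h.2⟩ else if i = j then 1 else 0

theorem padMatrix_one (m n : ℕ) : padMatrix n (1 : Matrix (Fin m) (Fin m) R) = 1 := by
  ext i j
  simp only [padMatrix, Matrix.of_apply, Matrix.one_apply, Fin.ext_iff]
  split_ifs <;> rfl

theorem padMatrix_mul {m n : ℕ} (hmn : m ≤ n) (A B : Matrix (Fin m) (Fin m) R) :
    padMatrix n (A * B) = padMatrix n A * padMatrix n B := by
  obtain ⟨l, rfl⟩ := Nat.exists_eq_add_of_le hmn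
  ext i j
  rw [Matrix.mul_apply, Fin.sum_univ_add]
  have h1 : ∀ (a : Fin m) (b : Fin l), (a : ℕ) ≠ m + b := fun a b => by omega
  have h2 : ∀ (a : Fin m) (b : Fin l), m + (b : ℕ) ≠ a := fun a b => by omega
  induction i using Fin.addCases <;> induction j using Fin.addCases <;>
    simp [padMatrix, Matrix.mul_apply, Fin.ext_iff, h1, h2]
  simp [← Fin.ext_iff]

theorem padMatrix_pad {m n l : ℕ} (hmn : m ≤ n) (A : Matrix (Fin m) (Fin m) R) :
    padMatrix l (padMatrix n A) = padMatrix l A := by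
  ext i j
  simp only [padMatrix, Matrix.of_apply, Fin.ext_iff]
  split_ifs <;> first | rfl | omega

theorem padMatrix_self {m : ℕ} (A : Matrix (Fin m) (Fin m) R) : padMatrix m A = A := by
  ext i j
  simp [padMatrix]

/-- The obvious inclusion `GL_m(R) → GL_n(R)`, `A ↦ diag(A, 1)`, for `m ≤ n`. -/
def glIncl (m n : ℕ) (hmn : m ≤ n) : GL (Fin m) R →* GL (Fin n) R :=
  Units.map
    { toFun := padMatrix n
      map_one' := padMatrix_one m n
      map_mul' := padMatrix_mul hmn }

variable (R) in
instance glDirectedSystem :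
    DirectedSystem (fun m : ℕ => GL (Fin m) R) (fun m n h => glIncl (R := R) m n h) where
  map_self _ A := Units.ext (padMatrix_self A.val)
  map_map _ _ _ hmn _ A := Units.ext (padMatrix_pad hmn A.val)

variable (R) in
/-- The stable linear group `GL(R)`, the direct limit of the `GL_m(R)`. -/
abbrev StableGL : Type _ :=
  DirectLimit (fun m : ℕ => GL (Fin m) R) (fun m n h => glIncl (R := R) m n h)

variable (R) in
/-- The canonical homomorphism `GL_m(R) → GL(R)`. -/
noncomputable def toStableGL (m : ℕ) : GL (Fin m) R →* StableGL R where
  toFun A := ⟦⟨m, A⟩⟧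
  map_one' := (DirectLimit.one_def (f := fun m n h => glIncl (R := R) m n h) m).symm
  map_mul' A B := (DirectLimit.mul_def (f := fun m n h => glIncl (R := R) m n h) m A B).symm

theorem single_neg_eq {m : ℕ} (i j : Fin m) (x : R) :
    Matrix.single i j (-x) = -Matrix.single i j x := by
  ext a b
  simp only [Matrix.single_apply, Matrix.neg_apply]
  split_ifs <;> simp

/-- The elementary matrix `E_{ij}(x)`, `i ≠ j`, as an element of `GL_m(R)`. -/
def elemGL {m : ℕ} {i j : Fin m} (hij : i ≠ j) (x : R) : GL (Fin m) R where
  val := 1 + Matrix.single i j x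
  inv := 1 + Matrix.single i j (-x)
  val_inv := by
    simp [mul_add, add_mul, Matrix.single_mul_single_of_ne _ _ _ _ hij.symm, single_neg_eq]
  inv_val := by
    simp [mul_add, add_mul, Matrix.single_mul_single_of_ne _ _ _ _ hij.symm, single_neg_eq]

variable (R) in
/-- The subgroup `E_m(R)` of `GL_m(R)` generated by all elementary matrices. -/
def elemSubgroup (m : ℕ) : Subgroup (GL (Fin m) R) :=
  Subgroup.closure {g | ∃ (i j : Fin m) (hij : i ≠ j) (x : R), g = elemGL hij x}

variable (R) in
/-- The subgroup `E(R)` of `GL(R)`, the union of the images of the `E_m(R)`. -/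
noncomputable def stableElem : Subgroup (StableGL R) :=
  ⨆ m : ℕ, (elemSubgroup R m).map (toStableGL R m)

/-! ### Normality of `E(R)` in `GL(R)` -/

theorem elemGL_mem {m : ℕ} {i j : Fin m} (hij : i ≠ j) (x : R) :
    elemGL hij x ∈ elemSubgroup R m :=
  Subgroup.subset_closure ⟨i, j, hij, x, rfl⟩

theorem col_mem_elemSubgroup {m : ℕ} (p : Fin m) (c : Fin m → R) (s : Finset (Fin m)) :
    p ∉ s → ∀ g : GL (Fin m) R, g.val = 1 + ∑ a ∈ s, Matrix.single a p (c a) →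
      g ∈ elemSubgroup R m := by
  induction s using Finset.induction_on with
  | empty =>
    intro _ g hg
    have : g = 1 := Units.ext (by simpa using hg)
    exact this ▸ one_mem _
  | insert b s hb ih =>
    intro hp g hg
    rw [Finset.mem_insert, not_or] at hp
    have hbp : b ≠ p := fun h => hp.1 h.symm
    have key : elemGL hbp (-c b) * g ∈ elemSubgroup R m := by
      refine ih hp.2 _ ?_
      have h0 : Matrix.single b p (-c b) * ∑ a ∈ s, Matrix.single a p (c a) = 0 := by
        rw [Finset.mul_sum]
        refine Finset.sum_eq_zero fun a ha => ?_
        exact Matrix.single_mul_single_of_ne _ _ _ _ (ne_of_mem_of_not_mem ha hp.2).symm _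
      have h1 : Matrix.single b p (-c b) * Matrix.single b p (c b) = 0 :=
        Matrix.single_mul_single_of_ne _ _ _ _ hbp.symm _
      rw [Units.val_mul, hg, Finset.sum_insert hb]
      simp only [elemGL, mul_add, add_mul, one_mul, mul_one, h0, h1]
      rw [single_neg_eq]
      abel
    exact (Subgroup.mul_mem_cancel_left _ (elemGL_mem hbp _)).1 key

theorem row_mem_elemSubgroup {m : ℕ} (p : Fin m) (c : Fin m → R) (s : Finset (Fin m)) :
    p ∉ s → ∀ g : GL (Fin m) R, g.val = 1 + ∑ a ∈ s, Matrix.single p a (c a) →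
      g ∈ elemSubgroup R m := by
  induction s using Finset.induction_on with
  | empty =>
    intro _ g hg
    have : g = 1 := Units.ext (by simpa using hg)
    exact this ▸ one_mem _
  | insert b s hb ih =>
    intro hp g hg
    rw [Finset.mem_insert, not_or] at hp
    have key : g * elemGL hp.1 (-c b) ∈ elemSubgroup R m := by
      refine ih hp.2 _ ?_
      have h0 : (∑ a ∈ s, Matrix.single p a (c a)) * Matrix.single p b (-c b) = 0 := by
        rw [Finset.sum_mul]
        refine Finset.sum_eq_zero fun a ha => ?_
        exact Matrix.single_mul_single_of_ne _ _ _ _ (ne_of_mem_of_not_mem ha hp.2) _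
      have h1 : Matrix.single p b (c b) * Matrix.single p b (-c b) = 0 :=
        Matrix.single_mul_single_of_ne _ _ _ _ (fun h => hp.1 h.symm) _
      rw [Units.val_mul, hg, Finset.sum_insert hb]
      simp only [elemGL, mul_add, add_mul, one_mul, mul_one, h0, h1]
      rw [single_neg_eq]
      abel
    exact (Subgroup.mul_mem_cancel_right _ (elemGL_mem hp.1 _)).1 key

theorem glIncl_elemGL {m n : ℕ} (hmn : m ≤ n) {i j : Fin m} (hij : i ≠ j) (x : R) :
    glIncl m n hmn (elemGL hij x) =
      elemGL (i := Fin.castLE hmn i) (j := Fin.castLE hmn j)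
        (fun h => hij (Fin.castLE_injective hmn h)) x := by
  refine Units.ext ?_
  ext a b
  simp only [glIncl, elemGL, padMatrix, Units.coe_map, MonoidHom.coe_mk, OneHom.coe_mk,
    Matrix.of_apply, Matrix.add_apply, Matrix.one_apply, Matrix.single_apply, Fin.ext_iff,
    Fin.val_castLE]
  have := i.isLt
  have := j.isLt
  split_ifs <;> first | rfl | omega | simp

theorem glIncl_mem_elemSubgroup {m n : ℕ} (hmn : m ≤ n) {g : GL (Fin m) R}
    (hg : g ∈ elemSubgroup R m) : glIncl m n hmn g ∈ elemSubgroup R n := by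
  have : elemSubgroup R m ≤ (elemSubgroup R n).comap (glIncl m n hmn) := by
    refine (Subgroup.closure_le _).2 ?_
    rintro _ ⟨i, j, hij, x, rfl⟩
    simpa only [Subgroup.coe_comap, Set.mem_preimage, glIncl_elemGL, SetLike.mem_coe]
      using elemGL_mem _ x
  exact this hg

theorem glIncl_conj_mem {m : ℕ} (g : GL (Fin m) R) {e : GL (Fin m) R}
    (he : e ∈ elemSubgroup R m) :
    glIncl m (m + 1) m.le_succ (g * e * g⁻¹) ∈ elemSubgroup R (m + 1) := by
  -- conjugation by `diag(g, 1)` maps the elementary matrices in the last column and in the last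
  -- row into `E_{m+1}(R)`, and the remaining ones are commutators of these
  set ι := glIncl (R := R) m (m + 1) m.le_succ with hι
  have hcol : ∀ (h : GL (Fin m) R) (a : Fin (m + 1)),
      (ι h).val a (Fin.last m) = if a = Fin.last m then 1 else 0 := by
    intro h a
    simp [hι, glIncl, padMatrix]
  have hrow : ∀ (h : GL (Fin m) R) (a : Fin (m + 1)),
      (ι h).val (Fin.last m) a = if a = Fin.last m then 1 else 0 := by
    intro h a
    simp [hι, glIncl, padMatrix, eq_comm]
  have conjcol : ∀ (i : Fin (m + 1)) (hi : i ≠ Fin.last m) (x : R),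
      ι g * elemGL hi x * (ι g)⁻¹ ∈ elemSubgroup R (m + 1) := by
    intro i hi x
    refine col_mem_elemSubgroup (Fin.last m) (fun a => (ι g).val a i * x)
      (Finset.univ.erase (Fin.last m)) (by simp) _ ?_
    have hz : Matrix.single (Fin.last m) (Fin.last m) ((ι g).val (Fin.last m) i * x) = 0 := by
      rw [hrow, if_neg hi, zero_mul, Matrix.single_zero]
    have hs : (ι g).val * Matrix.single i (Fin.last m) x * (ι g⁻¹).val =
        ∑ a, Matrix.single a (Fin.last m) ((ι g).val a i * x) := by
      ext a b
      rw [Matrix.sum_apply, Matrix.mul_apply, Finset.sum_eq_single (Fin.last m),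
        Matrix.mul_single_apply_same, hrow]
      · simp [Matrix.single_apply, eq_comm, ite_and]
      · intro c _ hc
        rw [Matrix.mul_single_apply_of_ne (hbj := hc), zero_mul]
      · simp
    rw [Finset.sum_erase (a := Fin.last m) _ hz, ← hs, ← map_inv, Units.val_mul, Units.val_mul]
    change _ * (1 + _) * _ = _
    rw [mul_add, mul_one, add_mul, ← Units.val_mul, ← map_mul, mul_inv_cancel, map_one,
      Units.val_one]
  have conjrow : ∀ (j : Fin (m + 1)) (hj : Fin.last m ≠ j) (x : R),
      ι g * elemGL hj x * (ι g)⁻¹ ∈ elemSubgroup R (m + 1) := by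
    intro j hj x
    refine row_mem_elemSubgroup (Fin.last m) (fun a => x * (ι g⁻¹).val j a)
      (Finset.univ.erase (Fin.last m)) (by simp) _ ?_
    have hz : Matrix.single (Fin.last m) (Fin.last m) (x * (ι g⁻¹).val j (Fin.last m)) = 0 := by
      rw [hcol, if_neg hj.symm, mul_zero, Matrix.single_zero]
    have hs : (ι g).val * (Matrix.single (Fin.last m) j x * (ι g⁻¹).val) =
        ∑ a, Matrix.single (Fin.last m) a (x * (ι g⁻¹).val j a) := by
      ext a b
      rw [Matrix.sum_apply, Matrix.mul_apply, Finset.sum_eq_single (Fin.last m),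
        Matrix.single_mul_apply_same, hcol]
      · simp [Matrix.single_apply, eq_comm, ite_and]
      · intro c _ hc
        rw [Matrix.single_mul_apply_of_ne (h := hc), mul_zero]
      · simp
    rw [Finset.sum_erase (a := Fin.last m) _ hz, ← hs, ← map_inv, Units.val_mul, Units.val_mul]
    change _ * (1 + _) * _ = _
    rw [mul_add, mul_one, add_mul, ← Units.val_mul, ← map_mul, mul_inv_cancel, map_one,
      Units.val_one, mul_assoc]
  have hle : elemSubgroup R m ≤
      (elemSubgroup R (m + 1)).comap ((MulAut.conj (ι g)).toMonoidHom.comp ι) := by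
    refine (Subgroup.closure_le _).2 ?_
    rintro _ ⟨i, j, hij, x, rfl⟩
    have hi : Fin.castLE m.le_succ i ≠ Fin.last m := (Fin.castSucc_lt_last i).ne
    have hj : Fin.last m ≠ Fin.castLE m.le_succ j := (Fin.castSucc_lt_last j).ne'
    have hcomm : ι (elemGL hij x) =
        elemGL hi x * elemGL hj 1 * (elemGL hi x)⁻¹ * (elemGL hj 1)⁻¹ := by
      rw [hι, glIncl_elemGL, eq_mul_inv_iff_mul_eq, eq_mul_inv_iff_mul_eq]
      refine Units.ext ?_
      have hji : Fin.castLE m.le_succ j ≠ Fin.castLE m.le_succ i :=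
        fun h => hij (Fin.castLE_injective _ h).symm
      simp only [elemGL, Units.val_mul, mul_add, add_mul, mul_one, one_mul,
        Matrix.single_mul_single_same, Matrix.single_mul_single_of_ne _ _ _ _ hj.symm,
        Matrix.single_mul_single_of_ne _ _ _ _ hji, zero_mul]
      abel
    have hconj : ι g * ι (elemGL hij x) * (ι g)⁻¹ =
        (ι g * elemGL hi x * (ι g)⁻¹) * (ι g * elemGL hj 1 * (ι g)⁻¹) *
          (ι g * elemGL hi x * (ι g)⁻¹)⁻¹ * (ι g * elemGL hj 1 * (ι g)⁻¹)⁻¹ := by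
      rw [hcomm]
      group
    change ι g * ι (elemGL hij x) * (ι g)⁻¹ ∈ elemSubgroup R (m + 1)
    rw [hconj]
    exact mul_mem (mul_mem (mul_mem (conjcol _ hi x) (conjrow _ hj 1))
      (inv_mem (conjcol _ hi x))) (inv_mem (conjrow _ hj 1))
  rw [map_mul, map_mul, map_inv]
  exact hle he

theorem toStableGL_glIncl {m n : ℕ} (hmn : m ≤ n) (g : GL (Fin m) R) :
    toStableGL R n (glIncl m n hmn g) = toStableGL R m g :=
  Quotient.sound ⟨n, le_rfl, hmn, DirectedSystem.map_self
    (f := fun m n h => glIncl (R := R) m n h) _⟩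

instance stableElem_normal : (stableElem R).Normal where
  conj_mem := by
    intro e he g
    have hle : stableElem R ≤ (stableElem R).comap (MulAut.conj g).toMonoidHom := by
      refine iSup_le fun m => ?_
      rintro _ ⟨e, he, rfl⟩
      obtain ⟨n, g, rfl⟩ := DirectLimit.exists_eq_mk _ g
      change toStableGL R n g * toStableGL R m e * (toStableGL R n g)⁻¹ ∈ stableElem R
      rw [← toStableGL_glIncl (le_max_left n m) g, ← toStableGL_glIncl (le_max_right n m) e,
        ← map_inv, ← map_mul, ← map_mul, ← toStableGL_glIncl (Nat.le_succ _)]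
      exact le_iSup (fun m : ℕ => (elemSubgroup R m).map (toStableGL R m)) (max n m + 1)
        ⟨_, glIncl_conj_mem _ (glIncl_mem_elemSubgroup (le_max_right n m) he), rfl⟩
    exact hle he

variable (R) in
/-- The Whitehead group `K_1(R) = GL(R) / E(R)`. -/
abbrev K1 : Type _ := StableGL R ⧸ stableElem R

variable (R) in
/-- The natural homomorphism `GL_m(R) → K_1(R)`. -/
noncomputable def toK1 (m : ℕ) : GL (Fin m) R →* K1 R :=
  (QuotientGroup.mk' (stableElem R)).comp (toStableGL R m)

end LinearGroups

/-- `S` is a set of representatives of the group homomorphism `f : G → H`: the image of `S`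
generates the image of `f`. Every set of representatives of the fibres of `f` has this property,
and so does every set whose image generates `H`. -/
def IsSetOfRepresentatives {G H : Type*} [Group G] [Group H] (f : G →* H) (S : Set G) : Prop :=
  Subgroup.closure (f '' S) = f.range

/-! ### Orders -/

section Orders

variable {F D : Type*} [Field F] [NumberField F] [DivisionRing D] [Algebra F D]

/-- An `𝓞 F`-order in `D`: a subring containing `𝓞 F` that is finitely generated over `𝓞 F` and
spans `D` over `F`. -/
structure IsOrder (Δ : Subalgebra (𝓞 F) D) : Prop where
  fg : (Subalgebra.toSubmodule Δ).FG
  span_eq_top : Submodule.span F (Δ : Set D) = ⊤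

/-- A maximal `𝓞 F`-order in `D`: an order that is maximal under inclusion. -/
def IsMaximalOrder (Δ : Subalgebra (𝓞 F) D) : Prop :=
  Maximal IsOrder Δ

/-- The ideal `𝔤Δ` of `Δ`. -/
def extIdeal (Δ : Subalgebra (𝓞 F) D) (𝔤 : Ideal (𝓞 F)) : Ideal Δ :=
  𝔤.map (algebraMap (𝓞 F) Δ)

instance extIdeal_isTwoSided (Δ : Subalgebra (𝓞 F) D) (𝔤 : Ideal (𝓞 F)) :
    (extIdeal Δ 𝔤).IsTwoSided where
  mul_mem_of_left := by
    intro a b ha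
    refine Submodule.span_induction (p := fun x _ => x * b ∈ extIdeal Δ 𝔤) ?_ ?_ ?_ ?_ ha
    · rintro _ ⟨r, hr, rfl⟩
      rw [Algebra.commutes]
      exact Ideal.mul_mem_left _ _ (Ideal.mem_map_of_mem _ hr)
    · rw [zero_mul]
      exact zero_mem _
    · intro x y _ _ hx hy
      rw [add_mul]
      exact add_mem hx hy
    · intro c x _ hx
      rw [smul_eq_mul, mul_assoc]
      exact Ideal.mul_mem_left _ _ hx

/-- The natural projection `π : GL_k(Δ) → GL_k(Δ / 𝔤Δ)`. -/
def projGL (Δ : Subalgebra (𝓞 F) D) (𝔤 : Ideal (𝓞 F)) (k : ℕ) :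
    GL (Fin k) Δ →* GL (Fin k) (Δ ⧸ extIdeal Δ 𝔤) :=
  glMap k (Ideal.Quotient.mk (extIdeal Δ 𝔤))

end Orders

/-! The proof combines surjective stability over `Δ` with injective stability over the finite ring
`Δ/𝔤Δ`.

Surjective stability (`IsOrder.exists_elem_mul_mul_eq_glIncl_two`): every matrix in `GL_k(Δ)` is `e
* diag(g', 1) * e'` with `e`, `e'` elementary and `g'` in `GL_2(Δ)`. A nonzero entry of a column is
invertible in `D`, so the left ideal that it generates contains `cΔ` for some nonzero `c` in `𝓞 F`.
The ring `Δ/cΔ` is finite, hence of stable range one, and this allows a column of length at least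
three to be given last entry `1`, which then serves as a pivot.

By the choice of `U'` there is `v` in the subgroup generated by `U'` with the same class in `K_1(Δ)`
as `g'`, so `v⁻¹ * g'` becomes elementary in some `GL_n(Δ)`. Its reduction modulo `𝔤` is then
elementary in `GL_n(Δ/𝔤Δ)`.

Injective stability (`mem_elemSubgroup_two_of_glIncl`): over a finite ring, a `2 × 2` matrix that is
elementary after enlargement is already in `E_2`. Hence the reduction of `g'` is that of `v` times
an elementary matrix. This stability rests on a factorisation of `E_{n+1}` into last row, last
column, last row, corner and diagonal factors (`mem_bigCell_of_mem_elemSubgroup`), whose key case is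
`elemGL_mul_mem_bigCell`. -/

/-! ### Stable range one for finite rings -/

section StableRange

/-- In a finite semisimple ring, a left unimodular pair `(p, q)` can be shortened to a unit
`q + s p`. -/
theorem IsSemisimpleRing.exists_isUnit_add_mul {R : Type*} [Ring R] [Finite R]
    [IsSemisimpleRing R] {p : R} :
    ∀ (N : ℕ) (q : R), Nat.card {x : R | x * q = 0} ≤ N → (∃ a b, a * p + b * q = 1) →
      ∃ s, IsUnit (q + s * p) := by
  intro N
  induction N with
  | zero =>
    intro q hq _
    have : Nonempty {x : R | x * q = 0} := ⟨⟨0, zero_mul q⟩⟩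
    exact absurd hq (not_le.2 Nat.card_pos)
  | succ N ih =>
    intro q hq ⟨a, b, hab⟩
    let φ : R →ₗ[R] R := LinearMap.toSpanSingleton R R q
    have hφ : ∀ x, φ x = x * q := fun x => rfl
    rcases eq_bot_or_exists_atom_le (LinearMap.ker φ) with hK | ⟨L, hL, hLK⟩
    · have hinj : Function.Injective φ := LinearMap.ker_eq_bot.1 hK
      obtain ⟨y, hy⟩ := Finite.surjective_of_injective hinj 1
      refine ⟨0, ?_⟩
      rw [zero_mul, add_zero]
      exact IsUnit.of_mul_eq_one_right y hy
    -- an idempotent `e` generating the simple left ideal `L`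
    obtain ⟨L', hLL'⟩ := exists_isCompl L
    obtain ⟨e, he, f, hf, hef⟩ : ∃ e ∈ L, ∃ f ∈ L', e + f = 1 :=
      Submodule.mem_sup.1 (hLL'.sup_eq_top ▸ Submodule.mem_top)
    have hmul : ∀ n ∈ L, n * e = n := by
      intro n hn
      have h1 : n * f = n - n * e := by rw [eq_sub_iff_add_eq', ← mul_add, hef, mul_one]
      have h2 : n * f ∈ L ⊓ L' :=
        ⟨h1 ▸ L.sub_mem hn (L.smul_mem n he), L'.smul_mem n hf⟩
      rw [hLL'.inf_eq_bot, Submodule.mem_bot, h1, sub_eq_zero] at h2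
      exact h2.symm
    have he0 : e ≠ 0 := by
      rintro rfl
      refine hL.1 ((Submodule.eq_bot_iff _).2 fun n hn => ?_)
      rw [← hmul n hn, mul_zero]
    have heq : e * q = 0 := hLK he
    -- Otherwise the two-sided ideal `I = ReR` satisfies `I ⊆ Iq`. As `I` is finite, right
    -- multiplication by `q` is then injective on `I`, although it kills `e ≠ 0`.
    obtain ⟨x, hx⟩ : ∃ x, e * x ∉ LinearMap.range φ := by
      by_contra! h
      let I : Submodule R R := Submodule.span R (Set.range fun x => e * x)
      have hI : I ≤ I.map φ := by
        refine Submodule.span_le.2 ?_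
        rintro _ ⟨x, rfl⟩
        obtain ⟨z, hz⟩ := h x
        refine ⟨e * z, Submodule.subset_span ⟨z, rfl⟩, ?_⟩
        rw [hφ] at hz ⊢
        dsimp only
        rw [mul_assoc, hz, ← mul_assoc, hmul e he]
      have hle : (I : Set R).ncard ≤ (φ '' (I : Set R)).ncard :=
        Set.ncard_le_ncard (fun x hx => hI hx) (Set.toFinite _)
      have hinj : Set.InjOn φ (I : Set R) :=
        Set.injOn_of_ncard_image_eq (le_antisymm (Set.ncard_image_le (Set.toFinite _)) hle)
          (Set.toFinite _)
      refine he0 (hinj (Submodule.subset_span ⟨1, mul_one e⟩) I.zero_mem ?_)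
      rw [map_zero]
      exact heq
    have hs : e * (x * a) * p ∉ LinearMap.range φ := by
      intro hmem
      refine hx ?_
      have : e * x = e * (x * a) * p + e * (x * b) * q := by
        rw [mul_assoc e, mul_assoc e, ← mul_add, mul_assoc, mul_assoc, ← mul_add, hab, mul_one]
      rw [this]
      exact add_mem hmem ⟨_, rfl⟩
    set s := e * (x * a) with hsdef
    have hes : e * s = s := by rw [hsdef, ← mul_assoc, hmul e he]
    -- The elements `l` of `L` with `l * s * p` in `Rq` form a left ideal that misses `e`, so it is
    -- zero because `L` is simple; `y * e` belongs to it.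
    have hker : ∀ y, y * (q + s * p) = 0 → y * e = 0 := by
      intro y hy
      let ψ : R →ₗ[R] R := LinearMap.toSpanSingleton R R (s * p)
      have hlt : L ⊓ (LinearMap.range φ).comap ψ < L := by
        refine lt_of_le_of_ne inf_le_left fun h => hs ?_
        have h1 : e ∈ L ⊓ (LinearMap.range φ).comap ψ := h.symm ▸ he
        have h2 : e * (s * p) ∈ LinearMap.range φ := h1.2
        rwa [← mul_assoc, hes] at h2
      have hmem : y * e ∈ L ⊓ (LinearMap.range φ).comap ψ := by
        refine ⟨L.smul_mem y he, ?_⟩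
        change y * e * (s * p) ∈ LinearMap.range φ
        refine ⟨-y, ?_⟩
        rw [hφ, mul_assoc y, ← mul_assoc e, hes, neg_mul, neg_eq_iff_add_eq_zero, ← mul_add, hy]
      rw [hL.2 _ hlt] at hmem
      exact hmem
    -- The new annihilator lies in the old one, since `y * e = 0` forces `y * s = 0`; it no longer
    -- contains `e`.
    have hcard : Nat.card {y : R | y * (q + s * p) = 0} ≤ N := by
      refine Nat.lt_succ_iff.1 (lt_of_lt_of_le ?_ hq)
      refine Set.ncard_lt_ncard (Set.ssubset_iff_subset_ne.2 ⟨fun y hy => ?_, fun h => ?_⟩)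
        (Set.toFinite _)
      · have h1 := hker y hy
        have h2 : y * (q + s * p) = 0 := hy
        rw [mul_add, ← hes, ← mul_assoc, ← mul_assoc y, h1, zero_mul, zero_mul, add_zero] at h2
        exact h2
      · have h1 : e ∈ {y : R | y * (q + s * p) = 0} := h ▸ heq
        have h2 := hker e h1
        rw [hmul e he] at h2
        exact he0 h2
    obtain ⟨t, ht⟩ := ih (q + s * p) hcard ⟨a - b * s, b, by rw [← hab]; noncomm_ring⟩
    exact ⟨s + t, by rwa [add_mul, ← add_assoc]⟩

/-- A finite ring has stable range one. -/
theorem exists_isUnit_add_mul_of_finite {R : Type*} [Ring R] [Finite R] {p q a b : R}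
    (h : a * p + b * q = 1) : ∃ s, IsUnit (q + s * p) := by
  have : Finite (R ⧸ Ring.jacobson R) := Quotient.finite _
  have : IsSemisimpleRing (R ⧸ Ring.jacobson R) := IsSemiprimaryRing.isSemisimpleRing
  let f := Ideal.Quotient.mk (Ring.jacobson R)
  obtain ⟨s', hs'⟩ := IsSemisimpleRing.exists_isUnit_add_mul (p := f p) _ (f q) le_rfl
    ⟨f a, f b, by rw [← map_mul, ← map_mul, ← map_add, h, map_one]⟩
  obtain ⟨s, rfl⟩ := Ideal.Quotient.mk_surjective s'
  obtain ⟨y', hy'⟩ := hs'.exists_left_inv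
  obtain ⟨y, rfl⟩ := Ideal.Quotient.mk_surjective y'
  refine ⟨s, ?_⟩
  -- Left invertibility lifts from the quotient by the Jacobson radical, and in a finite ring a left
  -- inverse is two-sided.
  have h1 : y * (q + s * p) - 1 ∈ Ideal.jacobson (⊥ : Ideal R) := by
    rw [Ideal.jacobson_bot, ← Ideal.Quotient.eq, map_one, ← hy', map_mul, map_add, map_mul]
  obtain ⟨z, hz⟩ := Ideal.exists_mul_sub_mem_of_sub_one_mem_jacobson _ h1
  rw [Submodule.mem_bot, sub_eq_zero, ← mul_assoc] at hz
  exact IsUnit.of_mul_eq_one_right _ hz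

end StableRange

/-! ### Steinberg relations and groups generated by elementary matrices at prescribed positions -/

section ElementaryRelations

variable {R : Type*} [Ring R] {m : ℕ}

/-- The diagonal matrix with given units on the diagonal. -/
def diagGL (d : Fin m → Rˣ) : GL (Fin m) R where
  val := Matrix.diagonal fun i => (d i : R)
  inv := Matrix.diagonal fun i => ((d i)⁻¹ : Rˣ)
  val_inv := by simp
  inv_val := by simp

theorem diagGL_mul (d d' : Fin m → Rˣ) : diagGL d * diagGL d' = diagGL (d * d') :=
  Units.ext (by simp [diagGL])

theorem diagGL_inv (d : Fin m → Rˣ) : (diagGL d)⁻¹ = diagGL d⁻¹ :=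
  Units.ext rfl

theorem elemGL_inv {i j : Fin m} (hij : i ≠ j) (x : R) : (elemGL hij x)⁻¹ = elemGL hij (-x) :=
  Units.ext rfl

theorem elemGL_mul {i j : Fin m} (hij : i ≠ j) (x y : R) :
    elemGL hij x * elemGL hij y = elemGL hij (x + y) := by
  refine Units.ext ?_
  simp only [elemGL, Units.val_mul, mul_add, add_mul, mul_one, one_mul,
    Matrix.single_mul_single_of_ne _ _ _ _ hij.symm, Matrix.single_add]
  abel

theorem elemGL_zero {i j : Fin m} (hij : i ≠ j) : elemGL hij (0 : R) = 1 :=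
  Units.ext (by simp [elemGL])

theorem elemGL_conj_of_ne {i j k l : Fin m} (hij : i ≠ j) (hkl : k ≠ l) (hjk : j ≠ k)
    (hli : l ≠ i) (a b : R) :
    elemGL hij a * elemGL hkl b * (elemGL hij a)⁻¹ = elemGL hkl b := by
  rw [mul_inv_eq_iff_eq_mul]
  refine Units.ext ?_
  simp only [elemGL, Units.val_mul, mul_add, add_mul, mul_one, one_mul,
    Matrix.single_mul_single_of_ne _ _ _ _ hjk, Matrix.single_mul_single_of_ne _ _ _ _ hli]
  abel

theorem elemGL_conj_left {i j l : Fin m} (hij : i ≠ j) (hjl : j ≠ l) (hil : i ≠ l) (a b : R) :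
    elemGL hij a * elemGL hjl b * (elemGL hij a)⁻¹ = elemGL hil (a * b) * elemGL hjl b := by
  rw [mul_inv_eq_iff_eq_mul]
  refine Units.ext ?_
  simp only [elemGL, Units.val_mul, mul_add, add_mul, mul_one, one_mul,
    Matrix.single_mul_single_of_ne _ _ _ _ hjl.symm,
    Matrix.single_mul_single_of_ne _ _ _ _ hil.symm, Matrix.single_mul_single_same, zero_mul]
  abel

theorem elemGL_conj_right {i j k : Fin m} (hij : i ≠ j) (hki : k ≠ i) (hkj : k ≠ j) (a b : R) :
    elemGL hij a * elemGL hki b * (elemGL hij a)⁻¹ = elemGL hkj (-(b * a)) * elemGL hki b := by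
  rw [mul_inv_eq_iff_eq_mul]
  refine Units.ext ?_
  simp only [elemGL, Units.val_mul, mul_add, add_mul, mul_one, one_mul,
    Matrix.single_mul_single_of_ne _ _ _ _ hij.symm,
    Matrix.single_mul_single_of_ne _ _ _ _ hkj.symm, Matrix.single_mul_single_same, zero_mul,
    single_neg_eq, neg_mul]
  abel

theorem diagGL_conj (d : Fin m → Rˣ) {i j : Fin m} (hij : i ≠ j) (x : R) :
    diagGL d * elemGL hij x * (diagGL d)⁻¹ = elemGL hij (d i * x * ((d j)⁻¹ : Rˣ)) := by
  rw [mul_inv_eq_iff_eq_mul]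
  refine Units.ext ?_
  simp only [elemGL, diagGL, Units.val_mul]
  rw [mul_add, add_mul, mul_one, one_mul]
  congr 1
  ext a b
  rw [Matrix.diagonal_mul, Matrix.mul_diagonal, Matrix.single_apply, Matrix.single_apply]
  split_ifs with h
  · rw [← h.1, ← h.2, Units.inv_mul_cancel_right]
  · simp

/-- The subgroup generated by the elementary matrices at the positions singled out by `P`. -/
def elemGroup (R : Type*) [Ring R] {m : ℕ} (P : Fin m → Fin m → Prop) : Subgroup (GL (Fin m) R) :=
  Subgroup.closure {g | ∃ (i j : Fin m) (hij : i ≠ j) (x : R), P i j ∧ g = elemGL hij x}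

theorem elemGL_mem_elemGroup {P : Fin m → Fin m → Prop} {i j : Fin m} (hij : i ≠ j)
    (hP : P i j) (x : R) : elemGL hij x ∈ elemGroup R P :=
  Subgroup.subset_closure ⟨i, j, hij, x, hP, rfl⟩

theorem elemGroup_le {P : Fin m → Fin m → Prop} {K : Subgroup (GL (Fin m) R)}
    (h : ∀ (i j : Fin m) (hij : i ≠ j) (x : R), P i j → elemGL hij x ∈ K) :
    elemGroup R P ≤ K := by
  refine (Subgroup.closure_le _).2 ?_
  rintro _ ⟨i, j, hij, x, hP, rfl⟩
  exact h i j hij x hP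

theorem elemSubgroup_eq_elemGroup : elemSubgroup R m = elemGroup R fun _ _ => True := by
  simp [elemSubgroup, elemGroup]

/-- A property that is inherited under left multiplication by elementary matrices is inherited
under left multiplication by the group that they generate. -/
theorem elemGroup_mul_mem {P : Fin m → Fin m → Prop} {S : Set (GL (Fin m) R)}
    (h : ∀ (i j : Fin m) (hij : i ≠ j) (x : R), P i j → ∀ y ∈ S, elemGL hij x * y ∈ S)
    {g : GL (Fin m) R} (hg : g ∈ elemGroup R P) : ∀ y ∈ S, g * y ∈ S := by
  induction hg using Subgroup.closure_induction_left with
  | one => simp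
  | mul_left x hx y _ ih =>
    obtain ⟨i, j, hij, a, hP, rfl⟩ := hx
    intro z hz
    rw [mul_assoc]
    exact h i j hij a hP _ (ih z hz)
  | inv_mul_cancel x hx y _ ih =>
    obtain ⟨i, j, hij, a, hP, rfl⟩ := hx
    intro z hz
    rw [mul_assoc, elemGL_inv]
    exact h i j hij _ hP _ (ih z hz)

theorem diagGL_conj_mem (d : Fin m → Rˣ) {P : Fin m → Fin m → Prop} {g : GL (Fin m) R}
    (hg : g ∈ elemGroup R P) : diagGL d * g * (diagGL d)⁻¹ ∈ elemGroup R P := by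
  have : elemGroup R P ≤ (elemGroup R P).comap (MulAut.conj (diagGL d)).toMonoidHom := by
    refine elemGroup_le fun i j hij x hP => ?_
    change diagGL d * elemGL hij x * (diagGL d)⁻¹ ∈ elemGroup R P
    rw [diagGL_conj]
    exact elemGL_mem_elemGroup hij hP _
  exact this hg

/-- The hypotheses say that composing a position in `Q` with one in `P`, on either side, gives an
off-diagonal position in `P`. They thereby exclude opposite positions, and the Steinberg relations
give the claim. -/
theorem elemGroup_conj_mem {P Q : Fin m → Fin m → Prop}
    (hleft : ∀ i j l, i ≠ j → j ≠ l → Q i j → P j l → i ≠ l ∧ P i l)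
    (hright : ∀ i j k, i ≠ j → k ≠ i → Q i j → P k i → k ≠ j ∧ P k j)
    {h g : GL (Fin m) R} (hh : h ∈ elemGroup R Q) (hg : g ∈ elemGroup R P) :
    h * g * h⁻¹ ∈ elemGroup R P := by
  have key : ∀ (i j : Fin m) (hij : i ≠ j) (a : R), Q i j → ∀ g ∈ elemGroup R P,
      elemGL hij a * g * (elemGL hij a)⁻¹ ∈ elemGroup R P := by
    intro i j hij a hQ g hg
    have : elemGroup R P ≤ (elemGroup R P).comap (MulAut.conj (elemGL hij a)).toMonoidHom := by
      refine elemGroup_le fun k l hkl x hP => ?_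
      change elemGL hij a * elemGL hkl x * (elemGL hij a)⁻¹ ∈ elemGroup R P
      by_cases hjk : j = k
      · subst hjk
        obtain ⟨hil, hP'⟩ := hleft i j l hij hkl hQ hP
        rw [elemGL_conj_left hij hkl hil]
        exact mul_mem (elemGL_mem_elemGroup _ hP' _) (elemGL_mem_elemGroup _ hP _)
      by_cases hli : l = i
      · subst hli
        obtain ⟨hkj, hP'⟩ := hright l j k hij hkl hQ hP
        rw [elemGL_conj_right hij hkl hkj]
        exact mul_mem (elemGL_mem_elemGroup _ hP' _) (elemGL_mem_elemGroup _ hP _)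
      rw [elemGL_conj_of_ne hij hkl hjk hli]
      exact elemGL_mem_elemGroup _ hP _
    exact this hg
  have hle : elemGroup R Q ≤ Subgroup.normalizer (elemGroup R P : Set (GL (Fin m) R)) := by
    refine elemGroup_le fun i j hij a hQ => ?_
    rw [Subgroup.mem_normalizer_iff]
    intro g
    refine ⟨key i j hij a hQ g, fun hg => ?_⟩
    have := key i j hij (-a) hQ _ hg
    rw [← elemGL_inv] at this
    simpa [mul_assoc] using this
  exact (Subgroup.mem_normalizer_iff.1 (hle hh) g).1 hg

/-- If the elementary matrices at the positions `Q` normalize those at the positions `P`, the group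
generated by all of them is a product. -/
theorem exists_mul_of_mem_elemGroup {P Q T : Fin m → Fin m → Prop}
    (hleft : ∀ i j l, i ≠ j → j ≠ l → Q i j → P j l → i ≠ l ∧ P i l)
    (hright : ∀ i j k, i ≠ j → k ≠ i → Q i j → P k i → k ≠ j ∧ P k j)
    (hT : ∀ i j, i ≠ j → T i j → P i j ∨ Q i j) {g : GL (Fin m) R} (hg : g ∈ elemGroup R T) :
    ∃ p ∈ elemGroup R P, ∃ q ∈ elemGroup R Q, g = p * q := by
  have := elemGroup_mul_mem (P := T)
    (S := {x : GL (Fin m) R | ∃ p ∈ elemGroup R P, ∃ q ∈ elemGroup R Q, x = p * q}) ?_ hg 1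
    ⟨1, one_mem _, 1, one_mem _, (one_mul 1).symm⟩
  · simpa using this
  · rintro i j hij x hx _ ⟨p, hp, q, hq, rfl⟩
    rcases hT i j hij hx with h | h
    · exact ⟨_, mul_mem (elemGL_mem_elemGroup hij h x) hp, q, hq, (mul_assoc _ _ _).symm⟩
    · have hx := elemGL_mem_elemGroup hij h x
      exact ⟨_, elemGroup_conj_mem hleft hright hx hp, _, mul_mem hx hq, by group⟩

theorem exists_eq_elemGL {p q : Fin m} (hpq : p ≠ q) {g : GL (Fin m) R}
    (hg : g ∈ elemGroup R fun i j => i = p ∧ j = q) : ∃ x, g = elemGL hpq x := by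
  have := elemGroup_mul_mem (S := {y : GL (Fin m) R | ∃ x, y = elemGL hpq x}) ?_ hg 1
    ⟨0, (elemGL_zero hpq).symm⟩
  · simpa using this
  · rintro i j hij x ⟨rfl, rfl⟩ _ ⟨y, rfl⟩
    exact ⟨x + y, elemGL_mul hij x y⟩

end ElementaryRelations

/-! ### Embedding `GL_2` at two chosen indices -/

section TwoByTwo

variable {R : Type*} [Ring R] {m : ℕ}

/-- The matrix that sends the two standard basis vectors to those with indices `p` and `q`. -/
def twoIncl (R : Type*) [Ring R] (p q : Fin m) : Matrix (Fin m) (Fin 2) R :=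
  Matrix.of fun i a => if i = ![p, q] a then 1 else 0

theorem twoIncl_transpose_mul {p q : Fin m} (hpq : p ≠ q) :
    (twoIncl R p q).transpose * twoIncl R p q = 1 := by
  ext a b
  simp only [Matrix.mul_apply, Matrix.transpose_apply, twoIncl, Matrix.of_apply, ite_mul, one_mul,
    zero_mul, Finset.sum_ite_eq', Finset.mem_univ, if_true]
  fin_cases a <;> fin_cases b <;> simp [hpq, hpq.symm]

/-- The embedding of `GL_2(R)` in `GL_m(R)` at the indices `p` and `q`. -/
def embTwo {p q : Fin m} (hpq : p ≠ q) : GL (Fin 2) R →* GL (Fin m) R :=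
  Units.map
    { toFun := fun A => 1 + twoIncl R p q * (A - 1) * (twoIncl R p q).transpose
      map_one' := by simp
      map_mul' := fun A B => by
        have h : ∀ X Y : Matrix (Fin 2) (Fin 2) R,
            twoIncl R p q * X * (twoIncl R p q).transpose *
              (twoIncl R p q * Y * (twoIncl R p q).transpose) =
            twoIncl R p q * (X * Y) * (twoIncl R p q).transpose := by
          intro X Y
          calc _ = twoIncl R p q * X * ((twoIncl R p q).transpose * twoIncl R p q) * Y *
                (twoIncl R p q).transpose := by simp only [Matrix.mul_assoc]
            _ = _ := by rw [twoIncl_transpose_mul hpq, Matrix.mul_one, Matrix.mul_assoc _ X Y]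
        have h2 : A * B - 1 = (A - 1) + (B - 1) + (A - 1) * (B - 1) := by noncomm_ring
        rw [h2, mul_add, add_mul, add_mul, h]
        simp only [Matrix.mul_add, Matrix.add_mul, one_mul, mul_one]
        abel }

theorem embTwo_elemGL {p q : Fin m} (hpq : p ≠ q) {i j : Fin 2} (hij : i ≠ j) (x : R)
    (hij' : ![p, q] i ≠ ![p, q] j) :
    embTwo hpq (elemGL hij x) = elemGL hij' x := by
  refine Units.ext ?_
  ext a b
  simp only [embTwo, elemGL, Units.coe_map, MonoidHom.coe_mk, OneHom.coe_mk, add_sub_cancel_left,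
    Matrix.add_apply]
  congr 1
  fin_cases i <;> fin_cases j <;> first | exact absurd rfl hij | skip
  all_goals
    simp [Matrix.mul_apply, twoIncl, Matrix.single_apply, Fin.sum_univ_two]
    split_ifs <;> first | rfl | grind

theorem embTwo_diagGL {p q : Fin m} (hpq : p ≠ q) (u v : Rˣ) :
    embTwo hpq (diagGL ![u, v]) =
      diagGL fun i => if i = p then u else if i = q then v else 1 := by
  refine Units.ext ?_
  ext a b
  simp [embTwo, diagGL, Matrix.mul_apply, twoIncl, Matrix.diagonal_apply, Fin.sum_univ_two,
    Matrix.one_apply]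
  by_cases h1 : a = p <;> by_cases h2 : a = q <;> by_cases h3 : a = b <;>
    first | (simp_all; done) | grind

end TwoByTwo

/-! ### Whitehead's identities and triangular factorisation of `2 × 2` matrices -/

section TwoByTwoDecomposition

variable {R : Type*} [Ring R]

/-- Whitehead's lemma: the first three factors give the antidiagonal matrix with entries `u⁻¹` and
`-u`, the last three the one with entries `-1` and `1`. -/
theorem diagGL_inv_self_mem (u : Rˣ) : diagGL ![u⁻¹, u] ∈ elemSubgroup R 2 := by
  have h01 : (0 : Fin 2) ≠ 1 := by decide
  have h10 : (1 : Fin 2) ≠ 0 := by decide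
  have : diagGL ![u⁻¹, u] = elemGL h01 ((u⁻¹ : Rˣ) : R) * elemGL h10 (-u : R) *
      elemGL h01 ((u⁻¹ : Rˣ) : R) * (elemGL h01 (-1) * elemGL h10 1 * elemGL h01 (-1)) := by
    refine Units.ext ?_
    ext i j
    fin_cases i <;> fin_cases j <;>
      simp [diagGL, elemGL, Matrix.mul_apply, Fin.sum_univ_two, Matrix.single_apply]
  rw [this]
  exact mul_mem (mul_mem (mul_mem (elemGL_mem _ _) (elemGL_mem _ _)) (elemGL_mem _ _))
    (mul_mem (mul_mem (elemGL_mem _ _) (elemGL_mem _ _)) (elemGL_mem _ _))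

/-- The commutator measures the failure of `u ↦ diag(u⁻¹, u)` to be multiplicative. -/
theorem diagGL_commutator_mem (u v : Rˣ) :
    diagGL ![u⁻¹ * v⁻¹ * u * v, 1] ∈ elemSubgroup R 2 := by
  have : diagGL ![u⁻¹ * v⁻¹ * u * v, 1] =
      diagGL ![u⁻¹, u] * diagGL ![v⁻¹, v] * (diagGL ![(u * v)⁻¹, u * v])⁻¹ := by
    rw [diagGL_inv, diagGL_mul, diagGL_mul]
    congr 1
    ext i
    fin_cases i <;> simp [mul_assoc]
  rw [this]
  exact mul_mem (mul_mem (diagGL_inv_self_mem u) (diagGL_inv_self_mem v))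
    (inv_mem (diagGL_inv_self_mem _))

theorem exists_eq_diagGL_two {M : GL (Fin 2) R} (h01 : M.val 0 1 = 0) (h10 : M.val 1 0 = 0) :
    ∃ u v, M = diagGL ![u, v] := by
  have hl : ∀ i j, (M.val * M⁻¹.val) i j = (1 : Matrix (Fin 2) (Fin 2) R) i j := by simp
  have hr : ∀ i j, (M⁻¹.val * M.val) i j = (1 : Matrix (Fin 2) (Fin 2) R) i j := by simp
  simp only [Matrix.mul_apply, Fin.sum_univ_two] at hl hr
  have hl0 := hl 0 0
  have hl1 := hl 1 1
  have hr0 := hr 0 0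
  have hr1 := hr 1 1
  simp only [h01, h10, zero_mul, mul_zero, add_zero, zero_add, Matrix.one_apply_eq]
    at hl0 hl1 hr0 hr1
  refine ⟨⟨M.val 0 0, M⁻¹.val 0 0, hl0, hr0⟩, ⟨M.val 1 1, M⁻¹.val 1 1, hl1, hr1⟩, ?_⟩
  refine Units.ext ?_
  ext i j
  fin_cases i <;> fin_cases j <;> simp [diagGL, h01, h10]

/-- Over a finite ring, an invertible `2 × 2` matrix is a product of three unipotent triangular
matrices and a diagonal matrix. -/
theorem exists_two_eq_mul_diagGL [Finite R] {h01 : (0 : Fin 2) ≠ 1} {h10 : (1 : Fin 2) ≠ 0}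
    (M : GL (Fin 2) R) : ∃ (s p q : R) (u v : Rˣ),
      M = elemGL h10 s * elemGL h01 p * elemGL h10 q * diagGL ![u, v] := by
  have hr : (M⁻¹.val * M.val) 1 1 = 1 := by simp
  rw [Matrix.mul_apply, Fin.sum_univ_two] at hr
  -- The second column is unimodular, so a row operation makes its lower entry a unit `w`. This
  -- pivot determines the `p` and `q` that clear the off-diagonal entries.
  obtain ⟨s, w, hw⟩ := exists_isUnit_add_mul_of_finite hr
  have hw' : s * M.val 0 1 + M.val 1 1 = w := by rw [hw, add_comm]
  obtain ⟨p, hp⟩ : ∃ p, p = -(M.val 0 1 * ((w⁻¹ : Rˣ) : R)) := ⟨_, rfl⟩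
  obtain ⟨q, hq⟩ : ∃ q, q = -(((w⁻¹ : Rˣ) : R) * (s * M.val 0 0 + M.val 1 0)) := ⟨_, rfl⟩
  obtain ⟨u, v, huv⟩ := exists_eq_diagGL_two
    (M := elemGL h01 p * (elemGL h10 s * M) * elemGL h10 q) (by
      simp [elemGL, Matrix.mul_apply, Fin.sum_univ_two, Matrix.single_apply, hw', hp])
    (by simp [elemGL, Matrix.mul_apply, Fin.sum_univ_two, Matrix.single_apply, hw', hq])
  refine ⟨-s, -p, v * (-q) * ((u⁻¹ : Rˣ) : R), u, v, ?_⟩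
  have hc := diagGL_conj ![u, v] h10 (-q)
  simp only [Matrix.cons_val_zero, Matrix.cons_val_one] at hc
  rw [← hc, ← huv, ← elemGL_inv, ← elemGL_inv, ← elemGL_inv]
  group

end TwoByTwoDecomposition

/-! ### Injective stability for `K_1` of a finite ring -/

section InjectiveStability

variable {R : Type*} [Ring R] {n : ℕ}

variable (R n) in
/-- The unipotent matrices that differ from the identity in the last row only. -/
def lastRow : Subgroup (GL (Fin (n + 1)) R) := elemGroup R fun i _ => i = Fin.last n

variable (R n) in
/-- The unipotent matrices that differ from the identity in the last column only. -/
def lastCol : Subgroup (GL (Fin (n + 1)) R) := elemGroup R fun _ j => j = Fin.last n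

variable (R n) in
/-- The image of `E_n(R)` in `GL_{n+1}(R)`. -/
def corner : Subgroup (GL (Fin (n + 1)) R) :=
  elemGroup R fun i j => i ≠ Fin.last n ∧ j ≠ Fin.last n

variable (n) in
/-- The diagonal matrix with `b` as its first entry and `1` elsewhere. -/
def diagFirst (b : Rˣ) : GL (Fin (n + 1)) R := diagGL fun i => if i = 0 then b else 1

variable (n) in
/-- The diagonal matrix with first entry `u⁻¹`, last entry `u`, and `1` elsewhere. -/
def diagEnds (u : Rˣ) : GL (Fin (n + 1)) R :=
  diagGL fun i => if i = 0 then u⁻¹ else if i = Fin.last n then u else 1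

variable (R n) in
/-- The set `lastRow * lastCol * lastRow * corner * diagEnds`. -/
def bigCell : Set (GL (Fin (n + 1)) R) :=
  {x | ∃ r ∈ lastRow R n, ∃ c ∈ lastCol R n, ∃ r' ∈ lastRow R n, ∃ h ∈ corner R n, ∃ u : Rˣ,
    x = r * c * r' * h * diagEnds n u}

theorem corner_conj_lastRow {h r : GL (Fin (n + 1)) R} (hh : h ∈ corner R n)
    (hr : r ∈ lastRow R n) : h * r * h⁻¹ ∈ lastRow R n :=
  elemGroup_conj_mem (fun _ _ _ _ _ hQ hP => absurd hP hQ.2)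
    (fun _ _ _ _ _ hQ hP => ⟨fun h => hQ.2 (h ▸ hP), hP⟩) hh hr

theorem corner_conj_lastCol {h c : GL (Fin (n + 1)) R} (hh : h ∈ corner R n)
    (hc : c ∈ lastCol R n) : h * c * h⁻¹ ∈ lastCol R n :=
  elemGroup_conj_mem (fun _ _ _ _ _ hQ hP => ⟨fun h => hQ.1 (h ▸ hP), hP⟩)
    (fun _ _ _ _ _ hQ hP => absurd hP hQ.1) hh hc

theorem elemGL_mem_lastRow {j : Fin (n + 1)} (h : Fin.last n ≠ j) (x : R) :
    elemGL h x ∈ lastRow R n :=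
  elemGL_mem_elemGroup h (P := fun i _ => i = Fin.last n) rfl x

theorem elemGL_mem_lastCol {i : Fin (n + 1)} (h : i ≠ Fin.last n) (x : R) :
    elemGL h x ∈ lastCol R n :=
  elemGL_mem_elemGroup h (P := fun _ j => j = Fin.last n) rfl x

theorem lastRow_mul_mem_bigCell {r x : GL (Fin (n + 1)) R} (hr : r ∈ lastRow R n)
    (hx : x ∈ bigCell R n) : r * x ∈ bigCell R n := by
  obtain ⟨r₀, hr₀, c, hc, r', hr', h, hh, u, rfl⟩ := hx
  exact ⟨r * r₀, mul_mem hr hr₀, c, hc, r', hr', h, hh, u, by simp only [mul_assoc]⟩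

theorem corner_mul_mem_bigCell {g x : GL (Fin (n + 1)) R} (hg : g ∈ corner R n)
    (hx : x ∈ bigCell R n) : g * x ∈ bigCell R n := by
  obtain ⟨r, hr, c, hc, r', hr', h, hh, u, rfl⟩ := hx
  exact ⟨_, corner_conj_lastRow hg hr, _, corner_conj_lastCol hg hc, _, corner_conj_lastRow hg hr',
    _, mul_mem hg hh, u, by group⟩

/-- In size at least three the indices `0` and `1` both differ from the last one, so the corner
contains a copy of `E_2` there. -/
theorem diagFirst_mem_corner {b : Rˣ} (hb : diagGL ![b, 1] ∈ elemSubgroup R 2) :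
    diagFirst (n + 2) b ∈ corner R (n + 2) := by
  have h01 : (0 : Fin (n + 3)) ≠ 1 := by simp
  have hle : elemSubgroup R 2 ≤ (corner R (n + 2)).comap (embTwo h01) := by
    refine (Subgroup.closure_le _).2 ?_
    rintro _ ⟨i, j, hij, x, rfl⟩
    have hij' : ![(0 : Fin (n + 3)), 1] i ≠ ![0, 1] j := by
      fin_cases i <;> fin_cases j <;> simp_all
    rw [SetLike.mem_coe, Subgroup.mem_comap, embTwo_elemGL h01 hij x hij']
    have hl : ∀ i : Fin 2, ![(0 : Fin (n + 3)), 1] i ≠ Fin.last (n + 2) := by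
      intro i
      fin_cases i <;> simp [Fin.ext_iff]
    exact elemGL_mem_elemGroup _ ⟨hl i, hl j⟩ x
  have := hle hb
  rw [Subgroup.mem_comap, embTwo_diagGL] at this
  convert this using 1
  simp [diagFirst]

theorem diagEnds_mul_diagEnds (u v : Rˣ) :
    diagEnds (n + 1) u * diagEnds (n + 1) v =
      diagFirst (n + 1) (u⁻¹ * v⁻¹ * u * v) * diagEnds (n + 1) (u * v) := by
  rw [diagEnds, diagEnds, diagEnds, diagFirst, diagGL_mul, diagGL_mul]
  congr 1
  ext i
  by_cases h0 : i = 0 <;> by_cases h1 : i = Fin.last (n + 1) <;> simp [h0, h1, mul_assoc]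

theorem embTwo_diagGL_ends (h : (0 : Fin (n + 2)) ≠ Fin.last (n + 1)) (u v : Rˣ) :
    embTwo h (diagGL ![u, v]) = diagFirst (n + 1) (u * v) * diagEnds (n + 1) v := by
  rw [embTwo_diagGL, diagFirst, diagEnds, diagGL_mul]
  congr 1
  ext i
  by_cases h0 : i = 0 <;> by_cases h1 : i = Fin.last (n + 1) <;> simp [h0, h1]

/-- Left multiplication by the elementary matrices in the upper right corner preserves the set
`bigCell`; this is where stable range one enters. -/
theorem elemGL_mul_mem_bigCell [Finite R] (h : (0 : Fin (n + 3)) ≠ Fin.last (n + 2)) (t : R)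
    {x : GL (Fin (n + 3)) R} (hx : x ∈ bigCell R (n + 2)) :
    elemGL h t * x ∈ bigCell R (n + 2) := by
  obtain ⟨r, hr, c, hc, ρ, hρ, k, hk, u, rfl⟩ := hx
  set L := Fin.last (n + 2) with hL
  obtain ⟨r', hr', r₀, hr₀, rfl⟩ := exists_mul_of_mem_elemGroup
    (P := fun i j => i = L ∧ j ≠ 0) (Q := fun i j => i = L ∧ j = 0)
    (by grind) (by grind) (by grind) hr
  obtain ⟨a, rfl⟩ := exists_eq_elemGL h.symm hr₀
  obtain ⟨c₀, hc₀, c', hc', rfl⟩ := exists_mul_of_mem_elemGroup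
    (P := fun i j => i = 0 ∧ j = L) (Q := fun i j => i ≠ 0 ∧ j = L)
    (by grind) (by grind) (by grind) hc
  obtain ⟨b, rfl⟩ := exists_eq_elemGL h hc₀
  -- Conjugation by the new factor spreads `r'` from the last row to the first; both kinds of factor
  -- preserve `bigCell` under left multiplication.
  have hK : elemGL h t * r' * (elemGL h t)⁻¹ ∈
      elemGroup R fun i j => (i = L ∨ i = 0) ∧ j ≠ L ∧ j ≠ 0 :=
    elemGroup_conj_mem (Q := fun i j => i = 0 ∧ j = L) (by grind) (by grind)
      (elemGL_mem_elemGroup h ⟨rfl, rfl⟩ t)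
      (elemGroup_le (fun i j hij x hP =>
        elemGL_mem_elemGroup hij (by grind) x) hr')
  have hKS : ∀ y ∈ bigCell R (n + 2),
      elemGL h t * r' * (elemGL h t)⁻¹ * y ∈ bigCell R (n + 2) := by
    refine elemGroup_mul_mem (fun i j hij x hP y hy => ?_) hK
    rcases hP.1 with rfl | rfl
    · exact lastRow_mul_mem_bigCell (elemGL_mem_lastRow hij x) hy
    · exact corner_mul_mem_bigCell (elemGL_mem_elemGroup hij ⟨h, hP.2.1⟩ x) hy
  -- rewrite the `2 × 2` part
  have h01 : (0 : Fin 2) ≠ 1 := by decide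
  have h10 : (1 : Fin 2) ≠ 0 := by decide
  have he01 : ∀ x : R, embTwo h (elemGL h01 x) = elemGL h x := fun x => embTwo_elemGL h h01 x h
  have he10 : ∀ x : R, embTwo h (elemGL h10 x) = elemGL h.symm x :=
    fun x => embTwo_elemGL h h10 x h.symm
  obtain ⟨s, p, q, v, w, hM⟩ := exists_two_eq_mul_diagGL (h01 := h01) (h10 := h10)
    (elemGL h01 t * elemGL h10 a * elemGL h01 b)
  -- By `hM` the matrix `diag(v, w)` is elementary, and Whitehead's lemma moves `w` into the first
  -- entry.
  have hvw : diagGL ![v * w, 1] ∈ elemSubgroup R 2 := by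
    have h1 : diagGL ![v, w] ∈ elemSubgroup R 2 := by
      rw [← inv_mul_eq_iff_eq_mul] at hM
      rw [← hM]
      exact mul_mem (inv_mem (mul_mem (mul_mem (elemGL_mem _ _) (elemGL_mem _ _))
        (elemGL_mem _ _))) (mul_mem (mul_mem (elemGL_mem _ _) (elemGL_mem _ _)) (elemGL_mem _ _))
    have h2 : diagGL ![v * w, 1] = diagGL ![v, w] * (diagGL ![w⁻¹, w])⁻¹ := by
      rw [diagGL_inv, diagGL_mul]
      congr 1
      ext i
      fin_cases i <;> simp
    rw [h2]
    exact mul_mem h1 (inv_mem (diagGL_inv_self_mem w))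
  obtain ⟨d, hd⟩ : ∃ d, embTwo h (diagGL ![v, w]) = diagGL d := ⟨_, embTwo_diagGL h v w⟩
  have hM' := congrArg (embTwo h) hM
  simp only [map_mul, he01, he10, hd] at hM'
  -- Moving `c'` to the left past the diagonal factor and `q` spreads it from the last column to the
  -- first; the result splits into a last-column part and a corner part.
  have hK' : elemGL h.symm q * (diagGL d * c' * (diagGL d)⁻¹) * (elemGL h.symm q)⁻¹ ∈
      elemGroup R fun i j => (j = L ∨ j = 0) ∧ i ≠ L ∧ i ≠ 0 :=
    elemGroup_conj_mem (Q := fun i j => i = L ∧ j = 0) (by grind) (by grind)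
      (elemGL_mem_elemGroup h.symm ⟨rfl, rfl⟩ q)
      (elemGroup_le (fun i j hij x hP =>
        elemGL_mem_elemGroup hij (by grind) x) (diagGL_conj_mem d hc'))
  obtain ⟨c₁, hc₁, k₁, hk₁, hck⟩ : ∃ c₁ ∈ lastCol R (n + 2), ∃ k₁ ∈ corner R (n + 2),
      elemGL h.symm q * (diagGL d * c' * (diagGL d)⁻¹) * (elemGL h.symm q)⁻¹ = c₁ * k₁ :=
    exists_mul_of_mem_elemGroup (by grind) (by grind) (by grind) hK'
  -- The two diagonal factors merge into one `diagEnds`. The errors, `v * w` and a commutator in the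
  -- first entry, are absorbed by the corner.
  have hdiag : diagGL d * k * diagEnds (n + 2) u =
      (diagFirst (n + 2) (v * w) * (diagEnds (n + 2) w * k * (diagEnds (n + 2) w)⁻¹) *
        diagFirst (n + 2) (w⁻¹ * u⁻¹ * w * u)) * diagEnds (n + 2) (w * u) := by
    rw [← hd, embTwo_diagGL_ends, mul_assoc _ _ (diagEnds (n + 2) (w * u)),
      ← diagEnds_mul_diagEnds]
    group
  have hmem : elemGL h t * r' * (elemGL h t)⁻¹ * (elemGL h.symm s *
      (1 * (elemGL h p * c₁) * (k₁ * (elemGL h.symm q * (diagGL d * ρ * (diagGL d)⁻¹)) * k₁⁻¹) *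
        (k₁ * (diagFirst (n + 2) (v * w) * (diagEnds (n + 2) w * k * (diagEnds (n + 2) w)⁻¹) *
          diagFirst (n + 2) (w⁻¹ * u⁻¹ * w * u))) * diagEnds (n + 2) (w * u))) ∈
      bigCell R (n + 2) :=
    hKS _ (lastRow_mul_mem_bigCell (elemGL_mem_lastRow _ _) ⟨_, one_mem _, _,
      mul_mem (elemGL_mem_lastCol _ _) hc₁, _, corner_conj_lastRow hk₁
        (mul_mem (elemGL_mem_lastRow _ _) (diagGL_conj_mem d hρ)), _,
      mul_mem hk₁ (mul_mem (mul_mem (diagFirst_mem_corner hvw) (diagGL_conj_mem _ hk))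
        (diagFirst_mem_corner (diagGL_commutator_mem w u))), _, rfl⟩)
  convert hmem using 1
  rw [mul_assoc _ (k₁ * _) (diagEnds _ _)]
  rw [mul_assoc k₁ _ (diagEnds _ _), ← hdiag]
  calc _ = elemGL h t * r' * (elemGL h t)⁻¹ * (elemGL h t * elemGL h.symm a * elemGL h b) *
        (c' * ρ * k * diagEnds (n + 2) u) := by group
    _ = elemGL h t * r' * (elemGL h t)⁻¹ * (elemGL h.symm s * elemGL h p *
        (elemGL h.symm q * (diagGL d * c' * (diagGL d)⁻¹) * (elemGL h.symm q)⁻¹) *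
          elemGL h.symm q * diagGL d * ρ * k * diagEnds (n + 2) u) := by rw [hM']; group
    _ = _ := by rw [hck]; group

theorem elemGL_mul_apply {m : ℕ} {i j : Fin m} (hij : i ≠ j) (x : R) (g : GL (Fin m) R)
    (a b : Fin m) :
    (elemGL hij x * g).val a b = g.val a b + if a = i then x * g.val j b else 0 := by
  rw [Units.val_mul]
  change ((1 + Matrix.single i j x) * g.val) a b = _
  rw [add_mul, one_mul, Matrix.add_apply]
  congr 1
  split_ifs with h
  · rw [h, Matrix.single_mul_apply_same]
  · rw [Matrix.single_mul_apply_of_ne (h := h)]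

/-- `bigCell` contains `1` and is stable under left multiplication by each elementary matrix. In the
last column only the position in row `0` needs stable range one. -/
theorem mem_bigCell_of_mem_elemSubgroup [Finite R] {x : GL (Fin (n + 3)) R}
    (hx : x ∈ elemSubgroup R (n + 3)) : x ∈ bigCell R (n + 2) := by
  rw [elemSubgroup_eq_elemGroup] at hx
  have h0 : (0 : Fin (n + 3)) ≠ Fin.last (n + 2) := by simp [Fin.ext_iff]
  have h1 : (1 : GL (Fin (n + 3)) R) ∈ bigCell R (n + 2) := by
    refine ⟨1, one_mem _, 1, one_mem _, 1, one_mem _, 1, one_mem _, 1, ?_⟩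
    have : diagEnds (n + 2) (1 : Rˣ) = 1 := Units.ext (by simp [diagEnds, diagGL])
    simp [this]
  have := elemGroup_mul_mem (S := bigCell R (n + 2)) ?_ hx 1 h1
  · rwa [mul_one] at this
  intro i j hij x _ y hy
  by_cases hi : i = Fin.last (n + 2)
  · subst hi
    exact lastRow_mul_mem_bigCell (elemGL_mem_lastRow hij x) hy
  by_cases hj : j = Fin.last (n + 2)
  · subst hj
    by_cases hi0 : i = 0
    · subst hi0
      exact elemGL_mul_mem_bigCell hij x hy
    have hc : ∀ a : R, elemGL hi0 a ∈ corner R (n + 2) :=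
      fun a => elemGL_mem_elemGroup hi0 ⟨hi, h0⟩ a
    -- The other positions of the last column are commutators of a corner matrix with the one in row
    -- `0`.
    have hcomm : elemGL hij x =
        elemGL hi0 x * (elemGL h0 1 * (elemGL hi0 (-x) * elemGL h0 (-1))) := by
      rw [← elemGL_inv, ← elemGL_inv, ← mul_assoc, ← mul_assoc, eq_mul_inv_iff_mul_eq,
        elemGL_conj_left hi0 h0 hij, mul_one]
    rw [hcomm, mul_assoc, mul_assoc, mul_assoc]
    exact corner_mul_mem_bigCell (hc _) (elemGL_mul_mem_bigCell h0 _
      (corner_mul_mem_bigCell (hc _) (elemGL_mul_mem_bigCell h0 _ hy)))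
  · exact corner_mul_mem_bigCell (elemGL_mem_elemGroup hij ⟨hi, hj⟩ x) hy

theorem lastRow_apply {r : GL (Fin (n + 1)) R} (hr : r ∈ lastRow R n) :
    (∀ i j, i ≠ Fin.last n → r.val i j = (1 : Matrix (Fin (n + 1)) (Fin (n + 1)) R) i j) ∧
      r.val (Fin.last n) (Fin.last n) = 1 := by
  have := elemGroup_mul_mem (S := {r : GL (Fin (n + 1)) R |
    (∀ i j, i ≠ Fin.last n → r.val i j = (1 : Matrix (Fin (n + 1)) (Fin (n + 1)) R) i j) ∧
      r.val (Fin.last n) (Fin.last n) = 1}) ?_ hr 1 (by simp)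
  · simpa using this
  · rintro i j hij x rfl y ⟨hy1, hy2⟩
    refine ⟨fun a b ha => ?_, ?_⟩
    · rw [elemGL_mul_apply, if_neg ha, add_zero, hy1 a b ha]
    · rw [elemGL_mul_apply, if_pos rfl, hy2, hy1 _ _ hij.symm, Matrix.one_apply_ne hij.symm,
        mul_zero, add_zero]

theorem lastCol_apply {c : GL (Fin (n + 1)) R} (hc : c ∈ lastCol R n) :
    (∀ i j, j ≠ Fin.last n → c.val i j = (1 : Matrix (Fin (n + 1)) (Fin (n + 1)) R) i j) ∧
      c.val (Fin.last n) (Fin.last n) = 1 := by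
  have := elemGroup_mul_mem (S := {c : GL (Fin (n + 1)) R |
    (∀ i j, j ≠ Fin.last n → c.val i j = (1 : Matrix (Fin (n + 1)) (Fin (n + 1)) R) i j) ∧
      c.val (Fin.last n) (Fin.last n) = 1}) ?_ hc 1 (by simp)
  · simpa using this
  · rintro i j hij x rfl y ⟨hy1, hy2⟩
    refine ⟨fun a b hb => ?_, ?_⟩
    · rw [elemGL_mul_apply, hy1 _ b hb, hy1 _ b hb, Matrix.one_apply_ne hb.symm, mul_zero, ite_self,
        add_zero]
    · rw [elemGL_mul_apply, if_neg hij.symm, add_zero, hy2]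

theorem glIncl_succ_apply (g : GL (Fin n) R) (i j : Fin n) :
    (glIncl n (n + 1) n.le_succ g).val i.castSucc j.castSucc = g.val i j := by
  simp [glIncl, padMatrix]

theorem glIncl_succ_last_row (g : GL (Fin n) R) (j : Fin (n + 1)) :
    (glIncl n (n + 1) n.le_succ g).val (Fin.last n) j =
      (1 : Matrix (Fin (n + 1)) (Fin (n + 1)) R) (Fin.last n) j := by
  simp [glIncl, padMatrix, Matrix.one_apply]

theorem glIncl_succ_last_col (g : GL (Fin n) R) (i : Fin (n + 1)) :
    (glIncl n (n + 1) n.le_succ g).val i (Fin.last n) =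
      (1 : Matrix (Fin (n + 1)) (Fin (n + 1)) R) i (Fin.last n) := by
  simp [glIncl, padMatrix, Matrix.one_apply]

theorem glIncl_succ_injective :
    Function.Injective (glIncl (R := R) n (n + 1) n.le_succ) := by
  intro g h hgh
  refine Units.ext ?_
  ext i j
  rw [← glIncl_succ_apply, hgh, glIncl_succ_apply]

theorem exists_eq_glIncl_of_mem_corner {h : GL (Fin (n + 1)) R} (hh : h ∈ corner R n) :
    ∃ α ∈ elemSubgroup R n, glIncl n (n + 1) n.le_succ α = h := by
  have : corner R n ≤ (elemSubgroup R n).map (glIncl n (n + 1) n.le_succ) := by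
    refine elemGroup_le fun i j hij x hP => ?_
    have hij' : i.castPred hP.1 ≠ j.castPred hP.2 := fun h => hij (Fin.castPred_inj.1 h)
    exact ⟨elemGL hij' x, elemGL_mem _ _, glIncl_elemGL _ hij' x⟩
  exact this hh

theorem mul_apply_last_of_col {x y : Matrix (Fin (n + 1)) (Fin (n + 1)) R}
    (hy : ∀ i, i ≠ Fin.last n → y i (Fin.last n) = 0) (i : Fin (n + 1)) :
    (x * y) i (Fin.last n) = x i (Fin.last n) * y (Fin.last n) (Fin.last n) := by
  rw [Matrix.mul_apply, Finset.sum_eq_single (Fin.last n)]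
  · intro b _ hb
    rw [hy b hb, mul_zero]
  · simp

/-- Injective stability for `K_1` over finite rings. -/
theorem mem_elemSubgroup_of_glIncl_succ [Finite R] {g : GL (Fin (n + 2)) R}
    (hg : glIncl (n + 2) (n + 3) (n + 2).le_succ g ∈ elemSubgroup R (n + 3)) :
    g ∈ elemSubgroup R (n + 2) := by
  obtain ⟨r, hr, c, hc, ρ, hρ, h, hh, u, hx⟩ := mem_bigCell_of_mem_elemSubgroup hg
  obtain ⟨α, hα, rfl⟩ := exists_eq_glIncl_of_mem_corner hh
  set ι := glIncl (R := R) (n + 2) (n + 3) (n + 2).le_succ with hι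
  set L := Fin.last (n + 2) with hL
  have hcol_row : ∀ r ∈ lastRow R (n + 2), ∀ i, i ≠ L → r.val i L = 0 := fun r hr i hi => by
    rw [(lastRow_apply hr).1 i L hi, Matrix.one_apply_ne hi]
  have hcol_incl : ∀ g i, i ≠ L → (ι g).val i L = 0 := fun g i hi => by
    rw [glIncl_succ_last_col, Matrix.one_apply_ne hi]
  have hcol_diag : ∀ i, i ≠ L → (diagEnds (n + 2) u).val i L = 0 := fun i hi => by
    simp [diagEnds, diagGL, Matrix.diagonal_apply_ne _ hi]
  have hdiag : (diagEnds (n + 2) u).val L L = u := by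
    have hL0 : L ≠ 0 := by simp [hL, Fin.ext_iff]
    simp [diagEnds, diagGL, ← hL, hL0]
  -- The last column of the right side is the last standard basis vector, and that of the left side
  -- is the last column of `c` times `u`. Comparison gives `u = 1` and then `c = 1`.
  have hc' : c * (ρ * (ι α * diagEnds (n + 2) u)) = r⁻¹ * ι g := by
    rw [hx]
    group
  have hlast : ∀ i, c.val i L * u = (1 : Matrix (Fin (n + 3)) (Fin (n + 3)) R) i L := by
    intro i
    have h1 : ∀ i, (ι α * diagEnds (n + 2) u).val i L =
        (1 : Matrix (Fin (n + 3)) (Fin (n + 3)) R) i L * u := by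
      intro i
      rw [Units.val_mul, mul_apply_last_of_col hcol_diag, glIncl_succ_last_col, hdiag]
    have h1' : ∀ i, i ≠ L → (ι α * diagEnds (n + 2) u).val i L = 0 := fun i hi => by
      rw [h1, Matrix.one_apply_ne hi, zero_mul]
    have h2 : ∀ i, (ρ * (ι α * diagEnds (n + 2) u)).val i L = ρ.val i L * u := by
      intro i
      rw [Units.val_mul, mul_apply_last_of_col h1', h1, Matrix.one_apply_eq, one_mul]
    have h2' : ∀ i, i ≠ L → (ρ * (ι α * diagEnds (n + 2) u)).val i L = 0 := fun i hi => by
      rw [h2, hcol_row ρ hρ i hi, zero_mul]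
    have h3 := congrArg (fun x : GL (Fin (n + 3)) R => x.val i L) hc'
    simp only [Units.val_mul c, Units.val_mul r⁻¹] at h3
    rw [mul_apply_last_of_col h2', mul_apply_last_of_col (hcol_incl g), h2,
      (lastRow_apply hρ).2, glIncl_succ_last_col, Matrix.one_apply_eq, mul_one, one_mul] at h3
    rw [h3]
    by_cases hi : i = L
    · rw [hi, Matrix.one_apply_eq]
      exact (lastRow_apply (inv_mem hr)).2
    · rw [hcol_row _ (inv_mem hr) i hi, Matrix.one_apply_ne hi]
  have hu : u = 1 := Units.ext (by simpa [(lastCol_apply hc).2, hL] using hlast L)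
  subst hu
  have hc1 : c = 1 := by
    refine Units.ext ?_
    ext i j
    by_cases hj : j = L
    · rw [hj]
      simpa using hlast i
    · exact (lastCol_apply hc).1 i j hj
  have hd1 : diagEnds (n + 2) (1 : Rˣ) = 1 := Units.ext (by simp [diagEnds, diagGL])
  rw [hc1, hd1, mul_one, mul_one, ← mul_inv_eq_iff_eq_mul, ← map_inv, ← map_mul] at hx
  -- What remains lies both in `lastRow` and in the image of `ι`, and these meet only in `1`.
  have hr1 : r * ρ = 1 := by
    refine Units.ext ?_
    ext i j
    by_cases hi : i = L
    · rw [← hx, hi, glIncl_succ_last_row]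
      rfl
    · exact (lastRow_apply (mul_mem hr hρ)).1 i j hi
  rw [hr1, ← map_one ι] at hx
  rw [← mul_inv_eq_one.1 (glIncl_succ_injective hx)] at hα
  exact hα

theorem mem_elemSubgroup_two_of_glIncl [Finite R] {g : GL (Fin 2) R} :
    ∀ {m : ℕ} (hm : 2 ≤ m), glIncl 2 m hm g ∈ elemSubgroup R m → g ∈ elemSubgroup R 2 := by
  intro m hm
  induction m, hm using Nat.le_induction with
  | base =>
    intro h
    rwa [(Units.ext (padMatrix_self g.val) : glIncl 2 2 le_rfl g = g)] at h
  | succ m hm ih =>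
    intro h
    obtain ⟨l, rfl⟩ := Nat.exists_eq_add_of_le' hm
    refine ih (mem_elemSubgroup_of_glIncl_succ ?_)
    rwa [(Units.ext (padMatrix_pad hm g.val) :
      glIncl (l + 2) (l + 3) (l + 2).le_succ (glIncl 2 (l + 2) hm g) = glIncl 2 (l + 3) _ g)]

end InjectiveStability

/-! ### Row and column operations, and reduction of the matrix size at a pivot -/

section SurjectiveStability

variable {R : Type*} [Ring R] {n : ℕ}

theorem exists_row_operation {m : ℕ} (p : Fin m) (t : Fin m → R) (s : Finset (Fin m)) :
    p ∉ s → ∀ g : GL (Fin m) R, ∃ e ∈ elemSubgroup R m, ∀ a b, (e * g).val a b =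
      g.val a b + if a = p then ∑ j ∈ s, t j * g.val j b else 0 := by
  induction s using Finset.induction_on with
  | empty => exact fun _ g => ⟨1, one_mem _, by simp⟩
  | insert c s hc ih =>
    intro hp g
    rw [Finset.mem_insert, not_or] at hp
    obtain ⟨e, he, h⟩ := ih hp.2 g
    refine ⟨elemGL hp.1 (t c) * e, mul_mem (elemGL_mem _ _) he, fun a b => ?_⟩
    rw [mul_assoc, elemGL_mul_apply, h, h, if_neg (Ne.symm hp.1), add_zero, Finset.sum_insert hc]
    split_ifs
    · rw [add_comm (t c * _), add_assoc]
    · simp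

/-- An invertible matrix with last row and last column those of the identity matrix comes from
`GL_n(R)`. -/
theorem exists_eq_glIncl_succ {g : GL (Fin (n + 1)) R}
    (hrow : ∀ j, g.val (Fin.last n) j = (1 : Matrix (Fin (n + 1)) (Fin (n + 1)) R) (Fin.last n) j)
    (hcol : ∀ i, g.val i (Fin.last n) = (1 : Matrix (Fin (n + 1)) (Fin (n + 1)) R) i (Fin.last n)) :
    ∃ g' : GL (Fin n) R, glIncl n (n + 1) n.le_succ g' = g := by
  have hne : ∀ i : Fin n, i.castSucc ≠ Fin.last n := fun i => (Fin.castSucc_lt_last i).ne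
  have key : ∀ x y : Matrix (Fin (n + 1)) (Fin (n + 1)) R, x * y = 1 →
      ((∀ i : Fin n, x i.castSucc (Fin.last n) = 0) ∨ ∀ i : Fin n, y (Fin.last n) i.castSucc = 0) →
      x.submatrix Fin.castSucc Fin.castSucc * y.submatrix Fin.castSucc Fin.castSucc = 1 := by
    intro x y hxy h0
    ext i j
    have := congrFun (congrFun hxy i.castSucc) j.castSucc
    rw [Matrix.mul_apply, Fin.sum_univ_castSucc] at this
    have hz : x i.castSucc (Fin.last n) * y (Fin.last n) j.castSucc = 0 := by
      rcases h0 with h | h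
      · rw [h, zero_mul]
      · rw [h, mul_zero]
    rw [hz, add_zero] at this
    simpa [Matrix.mul_apply, Matrix.one_apply] using this
  refine ⟨⟨g.val.submatrix Fin.castSucc Fin.castSucc, g⁻¹.val.submatrix Fin.castSucc Fin.castSucc,
    key _ _ (by simp) (Or.inl fun i => by rw [hcol, Matrix.one_apply_ne (hne i)]),
    key _ _ (by simp) (Or.inr fun i => by rw [hrow, Matrix.one_apply_ne (hne i).symm])⟩, ?_⟩
  refine Units.ext ?_
  ext i j
  induction i using Fin.lastCases with
  | last => rw [glIncl_succ_last_row, hrow]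
  | cast i =>
    induction j using Fin.lastCases with
    | last => rw [glIncl_succ_last_col, hcol]
    | cast j => rw [glIncl_succ_apply]; rfl

theorem mul_elemGL_apply {m : ℕ} {i j : Fin m} (hij : i ≠ j) (x : R) (g : GL (Fin m) R)
    (a b : Fin m) :
    (g * elemGL hij x).val a b = g.val a b + if b = j then g.val a i * x else 0 := by
  rw [Units.val_mul]
  change (g.val * (1 + Matrix.single i j x)) a b = _
  rw [mul_add, mul_one, Matrix.add_apply]
  congr 1
  split_ifs with h
  · rw [h, Matrix.mul_single_apply_same]
  · rw [Matrix.mul_single_apply_of_ne (hbj := h)]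

theorem exists_pivot_row_operation {m : ℕ} (p : Fin m) (t : Fin m → R) (s : Finset (Fin m)) :
    p ∉ s → ∀ g : GL (Fin m) R, ∃ e ∈ elemSubgroup R m, ∀ a b, (e * g).val a b =
      g.val a b + if a ∈ s then t a * g.val p b else 0 := by
  induction s using Finset.induction_on with
  | empty => exact fun _ g => ⟨1, one_mem _, by simp⟩
  | insert c s hc ih =>
    intro hp g
    rw [Finset.mem_insert, not_or] at hp
    obtain ⟨e, he, h⟩ := ih hp.2 g
    refine ⟨elemGL (Ne.symm hp.1) (t c) * e, mul_mem (elemGL_mem _ _) he, fun a b => ?_⟩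
    rw [mul_assoc, elemGL_mul_apply, h, h, if_neg hp.2, add_zero]
    by_cases hac : a = c
    · subst hac
      simp [hc]
    · simp [hac]

theorem exists_pivot_col_operation {m : ℕ} (p : Fin m) (t : Fin m → R) (s : Finset (Fin m)) :
    p ∉ s → ∀ g : GL (Fin m) R, ∃ e ∈ elemSubgroup R m, ∀ a b, (g * e).val a b =
      g.val a b + if b ∈ s then g.val a p * t b else 0 := by
  induction s using Finset.induction_on with
  | empty => exact fun _ g => ⟨1, one_mem _, by simp⟩
  | insert c s hc ih =>
    intro hp g
    rw [Finset.mem_insert, not_or] at hp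
    obtain ⟨e, he, h⟩ := ih hp.2 g
    refine ⟨e * elemGL hp.1 (t c), mul_mem he (elemGL_mem _ _), fun a b => ?_⟩
    rw [← mul_assoc, mul_elemGL_apply, h, h, if_neg hp.2, add_zero]
    by_cases hbc : b = c
    · subst hbc
      simp [hc]
    · simp [hbc]

/-- The entry `1` is a pivot: row operations clear the last column, then column operations clear the
last row without changing the last column. -/
theorem exists_elem_mul_mul_eq_glIncl {g : GL (Fin (n + 1)) R}
    (hg : g.val (Fin.last n) (Fin.last n) = 1) :
    ∃ e ∈ elemSubgroup R (n + 1), ∃ e' ∈ elemSubgroup R (n + 1), ∃ g' : GL (Fin n) R,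
      e * g * e' = glIncl n (n + 1) n.le_succ g' := by
  set L := Fin.last n with hL
  obtain ⟨e, he, h⟩ := exists_pivot_row_operation L (fun a => -g.val a L) (Finset.univ.erase L)
    (by simp) g
  obtain ⟨e', he', h'⟩ := exists_pivot_col_operation L (fun b => -g.val L b) (Finset.univ.erase L)
    (by simp) (e * g)
  have hcol : ∀ i, (e * g).val i L = (1 : Matrix (Fin (n + 1)) (Fin (n + 1)) R) i L := by
    intro i
    by_cases hi : i = L
    · rw [hi, Matrix.one_apply_eq, h, hg]
      simp
    · simp [h, hi, hg]
  have hrow : ∀ j, (e * g).val L j = g.val L j := by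
    intro j
    simp [h]
  obtain ⟨g', hg'⟩ := exists_eq_glIncl_succ (g := e * g * e')
    (fun j => by
      by_cases hj : j = L
      · rw [h', hrow, hj, ← hL]
        simp [hg]
      · rw [h', ← hL, hrow, hcol, Matrix.one_apply_ne (Ne.symm hj), Matrix.one_apply_eq]
        simp [hj])
    (fun i => by
      rw [h', ← hL, hcol]
      simp)
  exact ⟨e, he, e', he', g', hg'.symm⟩

end SurjectiveStability

/-! ### Finite quotients of orders and surjective stability -/

section Orders

variable {F D : Type*} [Field F] [NumberField F] [DivisionRing D] [Algebra F D]

theorem IsOrder.finite_quotient {Δ : Subalgebra (𝓞 F) D} (hΔ : IsOrder Δ) {𝔤 : Ideal (𝓞 F)}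
    (h𝔤 : 𝔤 ≠ ⊥) : Finite (Δ ⧸ extIdeal Δ 𝔤) := by
  have : Module.Finite (𝓞 F) Δ := Module.Finite.iff_fg.2 hΔ.fg
  have : Module.Finite ℤ Δ := Module.Finite.trans (𝓞 F) Δ
  let f : Δ →ₗ[ℤ] Δ ⧸ extIdeal Δ 𝔤 :=
    (Ideal.Quotient.mk (extIdeal Δ 𝔤)).toAddMonoidHom.toIntLinearMap
  have : Module.Finite ℤ (Δ ⧸ extIdeal Δ 𝔤) :=
    Module.Finite.of_surjective f Ideal.Quotient.mk_surjective
  -- The nonzero integer `Ideal.absNorm 𝔤` lies in `𝔤`, so it kills the quotient.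
  refine Module.finite_of_fg_torsion _ fun x => ?_
  have hN : (Ideal.absNorm 𝔤 : ℤ) ≠ 0 :=
    Nat.cast_ne_zero.2 (mt Ideal.absNorm_eq_zero_iff.1 h𝔤)
  refine ⟨⟨Ideal.absNorm 𝔤, mem_nonZeroDivisors_of_ne_zero hN⟩, ?_⟩
  obtain ⟨y, rfl⟩ := Ideal.Quotient.mk_surjective x
  change (Ideal.absNorm 𝔤 : ℤ) • Ideal.Quotient.mk (extIdeal Δ 𝔤) y = 0
  rw [← map_zsmul, Ideal.Quotient.eq_zero_iff_mem, zsmul_eq_mul, Int.cast_natCast,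
    ← map_natCast (algebraMap (𝓞 F) Δ)]
  exact Ideal.mul_mem_right _ _ (Ideal.mem_map_of_mem _ (Ideal.absNorm_mem 𝔤))

theorem IsOrder.exists_smul_mem {Δ : Subalgebra (𝓞 F) D} (hΔ : IsOrder Δ) (d : D) :
    ∃ c : 𝓞 F, c ≠ 0 ∧ c • d ∈ Δ := by
  have hd : d ∈ Submodule.span F (Δ : Set D) := hΔ.span_eq_top ▸ Submodule.mem_top
  induction hd using Submodule.span_induction with
  | mem x hx => exact ⟨1, one_ne_zero, by simpa using hx⟩
  | zero => exact ⟨1, one_ne_zero, by simp⟩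
  | add x y _ _ hx hy =>
    obtain ⟨a, ha, hax⟩ := hx
    obtain ⟨b, hb, hby⟩ := hy
    refine ⟨a * b, mul_ne_zero ha hb, ?_⟩
    rw [smul_add, mul_comm, mul_smul, mul_comm, mul_smul]
    exact add_mem (Δ.smul_mem hax b) (Δ.smul_mem hby a)
  | smul r x _ hx =>
    obtain ⟨a, ha, hax⟩ := hx
    obtain ⟨p, q, hq, rfl⟩ := IsFractionRing.div_surjective (A := 𝓞 F) r
    have hq0 : q ≠ 0 := nonZeroDivisors.ne_zero hq
    refine ⟨q * a, mul_ne_zero hq0 ha, ?_⟩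
    have : (q * a) • (algebraMap (𝓞 F) F p / algebraMap (𝓞 F) F q) • x = p • a • x := by
      have hq' : algebraMap (𝓞 F) F q ≠ 0 := by simpa using hq0
      rw [← algebraMap_smul F (q * a), ← algebraMap_smul F p, ← algebraMap_smul F a, smul_smul,
        smul_smul, map_mul]
      congr 1
      field_simp
    rw [this]
    exact Δ.smul_mem hax p

/-- Surjective stability for `K_1`: a column of length at least three over an order can be
transformed by elementary operations into one with last entry `1`. -/
theorem IsOrder.exists_elem_mul_last_eq_one {Δ : Subalgebra (𝓞 F) D} (hΔ : IsOrder Δ) {n : ℕ}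
    (g : GL (Fin (n + 3)) Δ) : ∃ e ∈ elemSubgroup Δ (n + 3),
      (e * g).val (Fin.last (n + 2)) (Fin.last (n + 2)) = 1 := by
  set L := Fin.last (n + 2) with hL
  have h01 : (0 : Fin (n + 3)) ≠ 1 := by simp
  have hL0 : L ≠ 0 := by simp [hL, Fin.ext_iff]
  have hL1 : L ≠ 1 := by simp [hL, Fin.ext_iff]
  have huni : ∀ g : GL (Fin (n + 3)) Δ, ∑ i, g⁻¹.val L i * g.val i L = 1 := fun g => by
    rw [← Matrix.mul_apply, ← Units.val_mul, inv_mul_cancel, Units.val_one, Matrix.one_apply_eq]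
  -- make the first entry nonzero
  obtain ⟨e₁, he₁, hne⟩ : ∃ e ∈ elemSubgroup Δ (n + 3), (e * g).val 0 L ≠ 0 := by
    by_cases h0 : g.val 0 L = 0
    · obtain ⟨j, hj⟩ : ∃ j, g.val j L ≠ 0 := by
        by_contra! h
        have := huni g
        simp [h] at this
      have h0j : 0 ≠ j := fun h => hj (h ▸ h0)
      refine ⟨elemGL h0j 1, elemGL_mem _ _, ?_⟩
      rwa [elemGL_mul_apply, if_pos rfl, h0, zero_add, one_mul]
    · exact ⟨1, one_mem _, by rwa [one_mul]⟩
  set g₁ := e₁ * g with hg₁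
  -- the left ideal generated by the first entry contains an ideal of finite index
  obtain ⟨c, hc, hcd⟩ := hΔ.exists_smul_mem ((g₁.val 0 L : D)⁻¹)
  have hca : algebraMap (𝓞 F) Δ c = ⟨_, hcd⟩ * g₁.val 0 L := by
    refine Subtype.ext ?_
    have hne' : (g₁.val 0 L : D) ≠ 0 := fun h => hne (Subtype.ext h)
    change algebraMap (𝓞 F) D c = c • (g₁.val 0 L : D)⁻¹ * (g₁.val 0 L : D)
    rw [smul_mul_assoc, inv_mul_cancel₀ hne', Algebra.algebraMap_eq_smul_one]
  have hideal : ∀ x ∈ extIdeal Δ (Ideal.span {c}), ∃ y, x = y * g₁.val 0 L := by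
    intro x hx
    rw [extIdeal, Ideal.map_span, Set.image_singleton] at hx
    obtain ⟨z, rfl⟩ := Ideal.mem_span_singleton'.1 hx
    exact ⟨z * ⟨_, hcd⟩, by rw [hca, mul_assoc]⟩
  have hfin : Finite (Δ ⧸ extIdeal Δ (Ideal.span {c})) :=
    hΔ.finite_quotient (by simpa using hc)
  let f := Ideal.Quotient.mk (extIdeal Δ (Ideal.span {c}))
  -- make the second entry a unit modulo that ideal
  obtain ⟨s', hs'⟩ := exists_isUnit_add_mul_of_finite (q := f (g₁.val 1 L))
    (p := f (∑ i ∈ Finset.univ.erase 1, g₁⁻¹.val L i * g₁.val i L)) (a := 1)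
    (b := f (g₁⁻¹.val L 1)) (by
      rw [one_mul, ← map_mul, ← map_add, Finset.sum_erase_add _ _ (Finset.mem_univ _), huni,
        map_one])
  obtain ⟨s, rfl⟩ := Ideal.Quotient.mk_surjective s'
  obtain ⟨e₂, he₂, h₂⟩ := exists_row_operation 1 (fun i => s * g₁⁻¹.val L i)
    (Finset.univ.erase 1) (by simp) g₁
  set g₂ := e₂ * g₁ with hg₂
  have hg0 : g₂.val 0 L = g₁.val 0 L := by rw [h₂, if_neg h01, add_zero]
  have hunit : IsUnit (f (g₂.val 1 L)) := by
    rw [h₂, if_pos rfl]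
    simp only [mul_assoc]
    rw [← Finset.mul_sum, map_add, map_mul]
    exact hs'
  obtain ⟨y', hy'⟩ := hunit.exists_left_inv
  obtain ⟨y, rfl⟩ := Ideal.Quotient.mk_surjective y'
  -- Now the entries of index `0` and `1` alone generate the unit left ideal. As `L` is a third
  -- index, multiples of these two rows can correct its entry to `1`.
  obtain ⟨z, hz⟩ : ∃ z, 1 - y * g₂.val 1 L = z * g₁.val 0 L := by
    refine hideal _ (Ideal.Quotient.eq.1 ?_)
    rw [map_one, map_mul, ← hy']
  refine ⟨elemGL hL1 ((1 - g₂.val L L) * y) * (elemGL hL0 ((1 - g₂.val L L) * z) * (e₂ * e₁)),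
    mul_mem (elemGL_mem _ _) (mul_mem (elemGL_mem _ _) (mul_mem he₂ he₁)), ?_⟩
  have hg : elemGL hL1 ((1 - g₂.val L L) * y) * (elemGL hL0 ((1 - g₂.val L L) * z) * (e₂ * e₁)) * g
      = elemGL hL1 ((1 - g₂.val L L) * y) * (elemGL hL0 ((1 - g₂.val L L) * z) * g₂) := by
    simp only [hg₂, hg₁, mul_assoc]
  rw [hg, elemGL_mul_apply, elemGL_mul_apply, elemGL_mul_apply, if_pos rfl, if_pos rfl,
    if_neg hL1.symm, add_zero, hg0, mul_assoc, mul_assoc, ← hz, add_assoc, ← mul_add,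
    sub_add_cancel, mul_one, add_sub_cancel]

theorem IsOrder.exists_elem_mul_mul_eq_glIncl_two {Δ : Subalgebra (𝓞 F) D} (hΔ : IsOrder Δ) {k : ℕ}
    (hk : 2 ≤ k) : ∀ g : GL (Fin k) Δ, ∃ e ∈ elemSubgroup Δ k, ∃ e' ∈ elemSubgroup Δ k,
      ∃ g' : GL (Fin 2) Δ, g = e * glIncl 2 k hk g' * e' := by
  induction k, hk using Nat.le_induction with
  | base =>
    exact fun g => ⟨1, one_mem _, 1, one_mem _, g, by
      rw [one_mul, mul_one]; exact (Units.ext (padMatrix_self g.val)).symm⟩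
  | succ k hk ih =>
    intro g
    obtain ⟨l, rfl⟩ := Nat.exists_eq_add_of_le' hk
    obtain ⟨e₁, he₁, h₁⟩ := hΔ.exists_elem_mul_last_eq_one g
    obtain ⟨e₂, he₂, e₃, he₃, g₁, h₂⟩ := exists_elem_mul_mul_eq_glIncl h₁
    obtain ⟨e, he, e', he', g', rfl⟩ := ih g₁
    refine ⟨e₁⁻¹ * e₂⁻¹ * glIncl _ _ (l + 2).le_succ e,
      mul_mem (mul_mem (inv_mem he₁) (inv_mem he₂)) (glIncl_mem_elemSubgroup _ he),
      glIncl _ _ (l + 2).le_succ e' * e₃⁻¹, mul_mem (glIncl_mem_elemSubgroup _ he') (inv_mem he₃),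
      g', ?_⟩
    rw [map_mul, map_mul, (Units.ext (padMatrix_pad hk g'.val) :
      glIncl (l + 2) (l + 3) (l + 2).le_succ (glIncl 2 (l + 2) hk g') =
        glIncl 2 (l + 3) (hk.trans (l + 2).le_succ) g')] at h₂
    calc g = e₁⁻¹ * e₂⁻¹ * (e₂ * (e₁ * g) * e₃) * e₃⁻¹ := by group
      _ = _ := by rw [h₂]; simp only [mul_assoc]

end Orders

/-! ### Functoriality of elementary subgroups and triviality in `K_1` -/

section Maps

variable {R S : Type*} [Ring R] [Ring S]

theorem glMap_elemGL (f : R →+* S) {m : ℕ} {i j : Fin m} (hij : i ≠ j) (x : R) :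
    glMap m f (elemGL hij x) = elemGL hij (f x) := by
  refine Units.ext ?_
  ext a b
  simp only [glMap, elemGL, Units.coe_map]
  change f ((1 + Matrix.single i j x : Matrix _ _ R) a b) = _
  simp only [Matrix.add_apply, map_add, Matrix.one_apply, Matrix.single_apply]
  split_ifs <;> simp

theorem glMap_mem_elemSubgroup (f : R →+* S) {m : ℕ} {g : GL (Fin m) R}
    (hg : g ∈ elemSubgroup R m) : glMap m f g ∈ elemSubgroup S m := by
  have : elemSubgroup R m ≤ (elemSubgroup S m).comap (glMap m f) := by
    refine (Subgroup.closure_le _).2 ?_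
    rintro _ ⟨i, j, hij, x, rfl⟩
    rw [SetLike.mem_coe, Subgroup.mem_comap, glMap_elemGL]
    exact elemGL_mem _ _
  exact this hg

theorem glMap_glIncl (f : R →+* S) {m n : ℕ} (hmn : m ≤ n) (g : GL (Fin m) R) :
    glMap n f (glIncl m n hmn g) = glIncl m n hmn (glMap m f g) := by
  refine Units.ext ?_
  ext a b
  simp only [glMap, glIncl, Units.coe_map]
  change f (padMatrix n g.val a b) = padMatrix n (g.val.map f) a b
  simp only [padMatrix, Matrix.of_apply, Matrix.map_apply]
  split_ifs <;> simp

theorem elemSubgroup_le_range_glMap {f : R →+* S} (hf : Function.Surjective f) (m : ℕ) :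
    elemSubgroup S m ≤ (glMap m f).range := by
  refine (Subgroup.closure_le _).2 ?_
  rintro _ ⟨i, j, hij, x, rfl⟩
  obtain ⟨y, rfl⟩ := hf x
  exact ⟨elemGL hij y, glMap_elemGL f hij y⟩

/-- The images of the `E_m(R)` in `GL(R)` increase with `m`, so membership in their supremum, and
then equality in the direct limit, is witnessed at a finite stage. -/
theorem exists_glIncl_mem_elemSubgroup {m : ℕ} {g : GL (Fin m) R} (hg : toK1 R m g = 1) :
    ∃ (n : ℕ) (hmn : m ≤ n), glIncl m n hmn g ∈ elemSubgroup R n := by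
  have h : toStableGL R m g ∈ stableElem R := (QuotientGroup.eq_one_iff _).1 hg
  have hdir : Directed (· ≤ ·) fun m : ℕ => (elemSubgroup R m).map (toStableGL R m) := by
    refine directed_of_isDirected_le fun a b hab => ?_
    rintro _ ⟨e, he, rfl⟩
    exact ⟨_, glIncl_mem_elemSubgroup hab he, toStableGL_glIncl hab e⟩
  obtain ⟨l, e, he, hel⟩ := (Subgroup.mem_iSup_of_directed hdir).1 h
  obtain ⟨n, hl, hm, hn⟩ := Quotient.exact hel
  refine ⟨n, hm, ?_⟩
  have hn : glIncl l n hl e = glIncl m n hm g := hn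
  rw [← hn]
  exact glIncl_mem_elemSubgroup hl he

end Maps

/-! ### Generation of the image of `GL_k(Δ)` -/

theorem mainTheorem7 {F D : Type*} [Field F] [NumberField F] [DivisionRing D] [Algebra F D]
    [Algebra.IsCentral F D] [FiniteDimensional F D]
    (Δ : Subalgebra (𝓞 F) D) (hΔ : IsMaximalOrder Δ)
    (𝔤 : Ideal (𝓞 F)) (h𝔤 : 𝔤 ≠ ⊥) (k : ℕ) (hk : 2 ≤ k)
    (U' : Set (GL (Fin 2) Δ)) (hU' : IsSetOfRepresentatives (toK1 Δ 2) U') :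
    (projGL Δ 𝔤 k).range =
      Subgroup.closure ((elemSubgroup (Δ ⧸ extIdeal Δ 𝔤) k : Set (GL (Fin k) (Δ ⧸ extIdeal Δ 𝔤))) ∪
        (fun u => projGL Δ 𝔤 k (glIncl 2 k hk u)) '' U') := by
  have hfin := hΔ.prop.finite_quotient h𝔤
  refine le_antisymm ?_ ((Subgroup.closure_le _).2 (Set.union_subset
    (elemSubgroup_le_range_glMap Ideal.Quotient.mk_surjective k) ?_))
  · rintro _ ⟨g, rfl⟩
    set K := Subgroup.closure ((elemSubgroup (Δ ⧸ extIdeal Δ 𝔤) k :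
      Set (GL (Fin k) (Δ ⧸ extIdeal Δ 𝔤))) ∪
        (fun u => projGL Δ 𝔤 k (glIncl 2 k hk u)) '' U') with hK
    have hEK : elemSubgroup (Δ ⧸ extIdeal Δ 𝔤) k ≤ K :=
      fun x hx => Subgroup.subset_closure (Or.inl hx)
    have hUK : Subgroup.closure U' ≤ K.comap ((projGL Δ 𝔤 k).comp (glIncl 2 k hk)) :=
      (Subgroup.closure_le _).2 fun u hu => Subgroup.subset_closure (Or.inr ⟨u, hu, rfl⟩)
    obtain ⟨e, he, e', he', g', rfl⟩ := hΔ.prop.exists_elem_mul_mul_eq_glIncl_two hk g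
    obtain ⟨v, hv, hvg⟩ : toK1 Δ 2 g' ∈ (Subgroup.closure U').map (toK1 Δ 2) := by
      rw [MonoidHom.map_closure, hU']
      exact ⟨g', rfl⟩
    obtain ⟨n, hn, hmem⟩ := exists_glIncl_mem_elemSubgroup (R := Δ) (g := v⁻¹ * g')
      (by rw [map_mul, map_inv, hvg, inv_mul_cancel])
    -- The reduction modulo `𝔤` comes before the descent from size `n` to size `2`, which relies on
    -- the finiteness of the quotient.
    have h2 : projGL Δ 𝔤 2 (v⁻¹ * g') ∈ elemSubgroup (Δ ⧸ extIdeal Δ 𝔤) 2 := by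
      refine mem_elemSubgroup_two_of_glIncl hn ?_
      rw [projGL, ← glMap_glIncl]
      exact glMap_mem_elemSubgroup _ hmem
    have h3 : projGL Δ 𝔤 k (glIncl 2 k hk (v⁻¹ * g')) ∈ K := by
      rw [projGL, glMap_glIncl]
      exact hEK (glIncl_mem_elemSubgroup hk h2)
    have h4 : projGL Δ 𝔤 k (glIncl 2 k hk v) ∈ K := hUK hv
    have h5 : projGL Δ 𝔤 k (glIncl 2 k hk g') ∈ K := by
      rw [← mul_inv_cancel_left v g', map_mul, map_mul]
      exact mul_mem h4 h3
    rw [map_mul, map_mul]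
    exact mul_mem (mul_mem (hEK (glMap_mem_elemSubgroup _ he)) h5)
      (hEK (glMap_mem_elemSubgroup _ he'))
  · rintro _ ⟨u, _, rfl⟩
    exact ⟨_, rfl⟩
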